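/- **Setting.** Let $M=\overline\Omega$ be a smooth manifold with (possibly empty) boundary and interior $\Omega$, with a measure $dx$ (for instance that of a volume form), and let $L$ be a self-adjoint operator on $L^2(M)$ with an orthonormal basis of $L^2(M)$ consisting of eigenfunctions $u_\xi$, $Lu_\xi=\lambda_\xi u_\xi$, $\xi\in\mathcal I$ (the boundary conditions are part of $\mathrm{Dom}(L)$). Fix $\nu>0$ (the order of $L$) and put $\langle\xi\rangle=(1+|\lambda_\xi|^2)^{1/(2\nu)}$. Assume the Weyl law $N(r)=\#\{\xi:\langle\xi\rangle\le r\}\sim r^Q$ for some $Q>0$, i.e. $N(r)$ is finite and lies between two positive multiples of $r^Q$ for large $r$. Let $L^\circ u_\xi=\overline{\lambda_\xi}u_\xi$ and $\mathcal M_q=(1+L^\circ L)^{q/(2\nu)}$, $q>0$. Let $C^\infty_L(M)=\bigcap_k\mathrm{Dom}(L^k)$ with the norms $\max_{j\le k}\|L^j\varphi\|_{L^2}$, and let $\mathcal D'_L(M)$ be the space of continuous linear functionals on $C^\infty_{L^*}(M)$. The symbol of a continuous linear operator $A:C^\infty_L(M)\to\mathcal D'_L(M)$ is the function $\sigma$ on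 $M\times\mathcal I$ with $Au_\xi=\sigma(\cdot,\xi)u_\xi$. For $0\le\rho,\delta\le1$ and $m\in\mathbb R$, $S^m_{\rho,\delta}(M\times\mathcal I)$ consists of the functions $a(x,\xi)$ that are smooth in $x$ and satisfy $|a(x,\xi)|\le C\langle\xi\rangle^m$ on $M\times\mathcal I$ and $|\Delta^\alpha_{q,(x)}D^{(\beta)}_xa(x,\xi)|\le C_{\alpha\beta}\langle\xi\rangle^{m-\rho|\alpha|+\delta|\beta|}$ for $x\in\Omega$ and all multi-indices $\alpha,\beta$. Here $q_1,\dots,q_l$ is some $L$-strongly admissible collection: functions on $M\times M$, smooth on $\Omega\times\Omega$, vanishing simultaneously exactly on the diagonal (each of them vanishing there), with $y$-gradients at $y=x\in\Omega$ of rank $\dim M$, and such that multiplication by $q_j(x,\cdot)$ is continuous on $C^\infty_L(M)$. The operators $D^{(\beta)}$, $D^{(0)}=I$, are its Taylor operators, given by $g(y)\sim\sum_\alpha\frac1{\alpha!}D^{(\alpha)}g(x)\,q^\alpha(x,y)$ as $y\to x$, and $$\Delta^\alpha_{q,(x)}a(x,\xi)=u_\xi(x)^{-1}\sum_\eta\Big(\int_M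 q^\alpha(x,y)u_\xi(y)\overline{u_\eta(y)}\,dy\Big)a(x,\eta)u_\eta(x)$$ where $u_\xi(x)\neq0$ (nothing is required at zeros of $u_\xi$). **Theorem.** Let $A:C^\infty_L(M)\to\mathcal D'_L(M)$ be a continuous linear operator with symbol $\sigma\in S^m_{\rho,\delta}(M\times\mathcal I)$ that is positive ($\sigma(x,\xi)\ge0$ for all $x,\xi$) and $L$-elliptic (there are $C_0>0$ and $N_0\in\mathbb N$ with $|\sigma(x,\xi)|\ge C_0\langle\xi\rangle^m$ whenever $\langle\xi\rangle\ge N_0$). For functions $f,g$ on a set $J\subset(0,\infty)$ write $f\sim g$ on $J$ if there are constants $c,C>0$ with $c\,g(t)\le f(t)\le C\,g(t)$ for all $t\in J$. Then for every $t>0$ the operator $Ae^{-t\mathcal M_q}$ is given by a trace class operator on $L^2(M)$, its trace is real, and: 1. For every $T>0$, on $(0,T]$, $$\mathrm{Tr}(Ae^{-t\mathcal M_q})\sim t^{-\frac{Q+m}{q}}\int_{t^{1/q}}^\infty e^{-s^q}s^{Q+m-1}\,ds .$$ 2. If $m=-Q$, then for every $0<T<1$, on $(0,T]$, $$\mathrm{Tr}(Ae^{-t\mathcal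 M_q})\sim-\frac1q\log t .$$ 3. If $m>-Q$, there are real numbers $b_k$, with $b_0=\frac1q\Gamma\big(\frac{Q+m}q\big)$, such that $\sum_{k\ge0}b_kt^{k/q}$ converges for all $t>0$ and, for every $T>0$, on $(0,T]$, $$\mathrm{Tr}(Ae^{-t\mathcal M_q})\sim t^{-\frac{Q+m}{q}}\sum_{k=0}^\infty b_kt^{k/q}.$$ If $q$ and $Q+m$ are integers, the $b_k$ can be taken such that moreover $\sum_kb_kt^{k/q}=\int_{t^{1/q}}^\infty e^{-s^q}s^{Q+m-1}\,ds$ for all $t>0$. For arbitrary $q>0$ and $Q+m>0$ this integral has, for all $t>0$, the expansion $$\int_{t^{1/q}}^\infty e^{-s^q}s^{Q+m-1}\,ds=b_0-\sum_{j=0}^\infty\frac{(-1)^j}{j!\,(Q+m+qj)}\,t^{\frac{Q+m}{q}+j}.$$ -/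

import Mathlib

open MeasureTheory Filter Topology Set
open scoped Manifold ContDiff ComplexConjugate

noncomputable section

namespace NonHarmonic

/-! ### Test functions and distributions of a densely defined operator -/

section Hilbert

variable {E : Type*} [NormedAddCommGroup E] [InnerProductSpace ℂ E]

/-- `Dom(L^k)`: the `f` with `L^j f ∈ Dom(L)` for `j = 0, …, k - 1`. -/
def domPow (L : E →ₗ.[ℂ] E) : ℕ → Submodule ℂ E
  | 0 => ⊤
  | k + 1 => ((domPow L k).comap L.toFun).map L.domain.subtype

/-- The space of test functions `C^∞_L = ⋂ₖ Dom(L^k)`. -/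
def testSpace (L : E →ₗ.[ℂ] E) : Submodule ℂ E := ⨅ k, domPow L k

theorem mem_domPow_succ {L : E →ₗ.[ℂ] E} {k : ℕ} {f : E} :
    f ∈ domPow L (k + 1) ↔ ∃ h : f ∈ L.domain, L ⟨f, h⟩ ∈ domPow L k := by
  constructor
  · rintro ⟨g, hg, rfl⟩
    exact ⟨g.2, hg⟩
  · rintro ⟨h, hf⟩
    exact ⟨⟨f, h⟩, hf, rfl⟩

theorem testSpace_le_domain (L : E →ₗ.[ℂ] E) : testSpace L ≤ L.domain := by
  intro f hf
  exact (mem_domPow_succ.1 ((Submodule.mem_iInf _).1 hf 1)).1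

theorem apply_mem_testSpace (L : E →ₗ.[ℂ] E) (f : testSpace L) :
    L ⟨f, testSpace_le_domain L f.2⟩ ∈ testSpace L := by
  refine (Submodule.mem_iInf _).2 fun k => ?_
  exact (mem_domPow_succ.1 ((Submodule.mem_iInf _).1 f.2 (k + 1))).2

/-- `L` as an endomorphism of `C^∞_L`. -/
def testMap (L : E →ₗ.[ℂ] E) : testSpace L →ₗ[ℂ] testSpace L :=
  (L.toFun ∘ₗ Submodule.inclusion (testSpace_le_domain L)).codRestrict (testSpace L)
    (apply_mem_testSpace L)

/-- The norm `‖φ‖_{C^k_L} = max_{j ≤ k} ‖L^j φ‖`; these norms define the topology of `C^∞_L`. -/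
def testNorm (L : E →ₗ.[ℂ] E) (k : ℕ) (φ : testSpace L) : ℝ :=
  (Finset.range (k + 1)).sup' Finset.nonempty_range_add_one
    fun j => ‖(((testMap L) ^ j) φ : E)‖

theorem testNorm_mono (L : E →ₗ.[ℂ] E) {k l : ℕ} (h : k ≤ l) (φ : testSpace L) :
    testNorm L k φ ≤ testNorm L l φ :=
  Finset.sup'_mono _ (Finset.range_mono (by omega)) _

theorem testNorm_nonneg (L : E →ₗ.[ℂ] E) (k : ℕ) (φ : testSpace L) : 0 ≤ testNorm L k φ :=
  (norm_nonneg _).trans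
    (Finset.le_sup' (fun j => ‖(((testMap L) ^ j) φ : E)‖) (Finset.mem_range.2 k.succ_pos))

/-- The space `D'_L` of `L`-distributions: the linear functionals on `C^∞_{L*}` that are
continuous, i.e. bounded by a multiple of one of the norms `‖·‖_{C^k_{L*}}`. -/
def LDistribution [CompleteSpace E] (L : E →ₗ.[ℂ] E) :
    Submodule ℂ (testSpace L.adjoint →ₗ[ℂ] ℂ) where
  carrier := {w | ∃ (c : ℝ) (k : ℕ), ∀ φ, ‖w φ‖ ≤ c * testNorm L.adjoint k φ}
  zero_mem' := ⟨0, 0, fun φ => by simp⟩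
  add_mem' := by
    rintro v w ⟨c, k, hv⟩ ⟨d, l, hw⟩
    refine ⟨|c| + |d|, max k l, fun φ => ?_⟩
    have h1 := testNorm_mono L.adjoint (le_max_left k l) φ
    have h2 := testNorm_mono L.adjoint (le_max_right k l) φ
    have h3 := testNorm_nonneg L.adjoint k φ
    have h4 := testNorm_nonneg L.adjoint l φ
    have h5 : c * testNorm L.adjoint k φ ≤ |c| * testNorm L.adjoint (max k l) φ :=
      mul_le_mul (le_abs_self c) h1 h3 (abs_nonneg c)
    have h6 : d * testNorm L.adjoint l φ ≤ |d| * testNorm L.adjoint (max k l) φ :=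
      mul_le_mul (le_abs_self d) h2 h4 (abs_nonneg d)
    have h7 := norm_add_le (v φ) (w φ)
    have h8 := hv φ
    have h9 := hw φ
    simp only [LinearMap.add_apply]
    linarith
  smul_mem' := by
    rintro a w ⟨c, k, hw⟩
    refine ⟨‖a‖ * c, k, fun φ => ?_⟩
    simp only [LinearMap.smul_apply, smul_eq_mul, norm_mul, mul_assoc]
    exact mul_le_mul_of_nonneg_left (hw φ) (norm_nonneg a)

/-- Continuity of a linear map `A : C^∞_L → D'_L`, where `D'_L` carries the topology of pointwise
convergence on test functions (for maps out of the complete space `C^∞_L` of a closed operator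
this is the same as continuity for the strong dual topology). -/
def IsContinuousOperator [CompleteSpace E] (L : E →ₗ.[ℂ] E)
    (A : testSpace L →ₗ[ℂ] LDistribution L) : Prop :=
  ∀ φ : testSpace L.adjoint, ∃ (c : ℝ) (k : ℕ), ∀ f : testSpace L,
    ‖(A f : testSpace L.adjoint →ₗ[ℂ] ℂ) φ‖ ≤ c * testNorm L k f

/-- The function `g` of an operator that is diagonal in the orthonormal basis `b`: it multiplies
the coefficient of index `ξ` by `g ξ`, on its maximal domain. -/
def diagonalOperator {ι : Type*} (b : HilbertBasis ι ℂ E) (g : ι → ℂ) : E →ₗ.[ℂ] E where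
  domain :=
    { carrier := {f | Memℓp (fun ξ => g ξ * b.repr f ξ) 2}
      zero_mem' := by
        refine cast (congrArg (fun a : ι → ℂ => Memℓp a 2) ?_) (zero_memℓp : Memℓp (0 : ι → ℂ) 2)
        funext ξ
        simp
      add_mem' := by
        intro f h hf hh
        have := Memℓp.add hf hh
        refine cast (congrArg (fun a : ι → ℂ => Memℓp a 2) ?_) this
        funext ξ
        simp only [Pi.add_apply, map_add, lp.coeFn_add, mul_add]
      smul_mem' := by
        intro c f hf
        have := Memℓp.const_smul hf c
        refine cast (congrArg (fun a : ι → ℂ => Memℓp a 2) ?_) this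
        funext ξ
        simp [mul_left_comm] }
  toFun :=
    { toFun := fun f => b.repr.symm ⟨fun ξ => g ξ * b.repr (f : E) ξ, f.2⟩
      map_add' := by
        intro f h
        rw [← map_add]
        congr 1
        ext ξ
        simp only [Submodule.coe_add, map_add, lp.coeFn_add, Pi.add_apply, mul_add]
      map_smul' := by
        intro c f
        rw [← map_smul]
        congr 1
        ext ξ
        simp [mul_left_comm] }

/-- Trace class (nuclear) operators on a Hilbert space: `T = ∑ₖ ⟨·, yₖ⟩ xₖ` with
`∑ₖ ‖xₖ‖ ‖yₖ‖ < ∞`. -/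
def IsTraceClass (T : E →L[ℂ] E) : Prop :=
  ∃ x y : ℕ → E, Summable (fun k => ‖x k‖ * ‖y k‖) ∧
    ∀ f, HasSum (fun k => inner ℂ (y k) f • x k) (T f)

/-- `T` is of trace class and its trace, computed in any orthonormal basis, is `τ`. -/
def HasTrace (T : E →L[ℂ] E) (τ : ℂ) : Prop :=
  IsTraceClass T ∧
    ∀ (s : Set E) (b : HilbertBasis s ℂ E), HasSum (fun i => inner ℂ (b i) (T (b i))) τ

end Hilbert

/-! ### The model operator and its symbolic calculus -/

/-- Eigenvalues `λ_ξ` and eigenfunctions `u_ξ` of `L`, the classes of the latter being an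
orthonormal basis of `L²(M)`. The `u_ξ` are actual functions on `M`. -/
structure EigenSystem {M : Type*} [MeasurableSpace M] (μ : Measure M)
    (L : Lp ℂ 2 μ →ₗ.[ℂ] Lp ℂ 2 μ) (ι : Type*) where
  /-- the eigenvalues -/
  ev : ι → ℂ
  /-- the eigenfunctions -/
  u : ι → M → ℂ
  /-- their classes in `L²` -/
  basis : HilbertBasis ι ℂ (Lp ℂ 2 μ)
  basis_ae_eq : ∀ ξ, basis ξ =ᵐ[μ] u ξ
  mem_domain : ∀ ξ, basis ξ ∈ L.domain
  apply_eq : ∀ ξ, L ⟨basis ξ, mem_domain ξ⟩ = ev ξ • basis ξ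

section Measure

variable {M : Type*} [MeasurableSpace M] {μ : Measure M}
  {L : Lp ℂ 2 μ →ₗ.[ℂ] Lp ℂ 2 μ} {ι : Type*}

theorem EigenSystem.mem_testSpace (S : EigenSystem μ L ι) (ξ : ι) : S.basis ξ ∈ testSpace L := by
  refine (Submodule.mem_iInf _).2 fun k => ?_
  induction k with
  | zero => exact Submodule.mem_top
  | succ k ih =>
    refine mem_domPow_succ.2 ⟨S.mem_domain ξ, ?_⟩
    rw [S.apply_eq]
    exact Submodule.smul_mem _ _ ih

/-- `⟨ξ⟩ = (1 + |λ_ξ|²)^{1/(2ν)}`. -/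
def EigenSystem.weight (S : EigenSystem μ L ι) (ν : ℝ) (ξ : ι) : ℝ :=
  (1 + ‖S.ev ξ‖ ^ 2) ^ (1 / (2 * ν))

/-- The eigenvalue counting function `N(r)` of `(1 + L°L)^{1/(2ν)}`. -/
def EigenSystem.counting (S : EigenSystem μ L ι) (ν r : ℝ) : ℕ :=
  {ξ | S.weight ν ξ ≤ r}.ncard

/-- The Weyl law `N(r) ∼ r^Q`: the counting function is finite and, for large `r`, bounded above and
below by positive multiples of `r^Q`. -/
def EigenSystem.WeylLaw (S : EigenSystem μ L ι) (ν Q : ℝ) : Prop :=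
  (∀ r, {ξ | S.weight ν ξ ≤ r}.Finite) ∧
    (fun r : ℝ => (S.counting ν r : ℝ)) =Θ[atTop] fun r => r ^ Q

/-- `M_q = (1 + L°L)^{q/(2ν)}`, where `L°u_ξ = conj(λ_ξ) u_ξ`, has eigenvalue
`(1 + |λ_ξ|²)^{q/(2ν)}` on `u_ξ`; this is the operator `exp(-t M_q)`. -/
def EigenSystem.heat (S : EigenSystem μ L ι) (ν q t : ℝ) : Lp ℂ 2 μ →ₗ.[ℂ] Lp ℂ 2 μ :=
  diagonalOperator S.basis fun ξ =>
    (Real.exp (-t * (1 + ‖S.ev ξ‖ ^ 2) ^ (q / (2 * ν))) : ℂ)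

/-- The distribution `w` is given by the function `ψ`: `⟨w, φ⟩ = ∫ ψ φ`. -/
def IsGivenBy (w : LDistribution L) (ψ : M → ℂ) : Prop :=
  ∀ φ : testSpace L.adjoint,
    (w : testSpace L.adjoint →ₗ[ℂ] ℂ) φ = ∫ x, ψ x * (φ : Lp ℂ 2 μ) x ∂μ

/-- `σ` is the `L`-symbol of `A`: `A u_ξ = σ(·, ξ) u_ξ` for all `ξ`. -/
def HasSymbol (S : EigenSystem μ L ι) (A : testSpace L →ₗ[ℂ] LDistribution L)
    (σ : M → ι → ℂ) : Prop :=
  ∀ ξ, IsGivenBy (A ⟨S.basis ξ, S.mem_testSpace ξ⟩) fun x => σ x ξ * S.u ξ x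

/-- `Tr(A exp(-t M_q)) = τ`: the operator `exp(-t M_q)` maps `L²(M)` into `C^∞_L`, the composition
`A exp(-t M_q)` is given by a bounded operator `T` on `L²(M)`, and `T` is of trace class with
trace `τ`. -/
def HasHeatTrace (S : EigenSystem μ L ι) (ν q : ℝ) (A : testSpace L →ₗ[ℂ] LDistribution L)
    (t : ℝ) (τ : ℂ) : Prop :=
  ∃ T : Lp ℂ 2 μ →L[ℂ] Lp ℂ 2 μ,
    (∀ f, ∃ (hf : f ∈ (S.heat ν q t).domain) (hg : S.heat ν q t ⟨f, hf⟩ ∈ testSpace L),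
      IsGivenBy (A ⟨S.heat ν q t ⟨f, hf⟩, hg⟩) (T f)) ∧
    HasTrace T τ

/-- Positivity of a symbol: `σ(x, ξ) ≥ 0` everywhere. -/
def IsPositiveSymbol (σ : M → ι → ℂ) : Prop :=
  ∀ x ξ, 0 ≤ (σ x ξ).re ∧ (σ x ξ).im = 0

/-- `L`-ellipticity of order `m`: `|σ(x, ξ)| ≥ C₀ ⟨ξ⟩^m` whenever `⟨ξ⟩ ≥ N₀`. -/
def IsLElliptic (S : EigenSystem μ L ι) (ν m : ℝ) (σ : M → ι → ℂ) : Prop :=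
  ∃ (C₀ : ℝ) (N₀ : ℕ), 0 < C₀ ∧
    ∀ x ξ, (N₀ : ℝ) ≤ S.weight ν ξ → C₀ * S.weight ν ξ ^ m ≤ ‖σ x ξ‖

/-- `q^α(x, y) = ∏ⱼ qⱼ(x, y)^{αⱼ}`. -/
def qPow {l : ℕ} (q : Fin l → M → M → ℂ) (α : Fin l → ℕ) (x y : M) : ℂ :=
  ∏ j, q j x y ^ α j

/-- The difference operator
`(Δ^α_{q,(x)} a)(x, ξ) = u_ξ(x)⁻¹ ∑_η F_L(q^α(x,·) u_ξ)(η) a(x, η) u_η(x)`; here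
`F_L h (η) = ∫ h conj(u_η)`. It imposes nothing at the zeros of `u_ξ`, of which there are none when
the eigenfunctions form a WZ-system. -/
def difference (S : EigenSystem μ L ι) {l : ℕ} (q : Fin l → M → M → ℂ) (α : Fin l → ℕ)
    (a : M → ι → ℂ) (x : M) (ξ : ι) : ℂ :=
  (S.u ξ x)⁻¹ *
    ∑' η, (∫ y, qPow q α x y * S.u ξ y * conj (S.u η y) ∂μ) * a x η * S.u η x

end Measure

section Manifold

variable {n : ℕ} [NeZero n] {M : Type*} [TopologicalSpace M]
  [ChartedSpace (EuclideanHalfSpace n) M] [MeasurableSpace M] {μ : Measure M}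
  {L : Lp ℂ 2 μ →ₗ.[ℂ] Lp ℂ 2 μ} {ι : Type*}

/-- The differential of `g : M → ℂ` at `x`. -/
def differential (n : ℕ) [NeZero n] {M : Type*} [TopologicalSpace M]
    [ChartedSpace (EuclideanHalfSpace n) M] (g : M → ℂ) (x : M) :
    EuclideanSpace ℝ (Fin n) →L[ℝ] ℂ :=
  mfderiv (𝓡∂ n) 𝓘(ℝ, ℂ) g x

/-- `L`-strongly admissible collections `q₁, …, q_l`. -/
structure StronglyAdmissible (n : ℕ) [NeZero n] {M : Type*} [TopologicalSpace M]
    [ChartedSpace (EuclideanHalfSpace n) M] [MeasurableSpace M] {μ : Measure M}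
    (L : Lp ℂ 2 μ →ₗ.[ℂ] Lp ℂ 2 μ) {l : ℕ} (q : Fin l → M → M → ℂ) : Prop where
  smooth : ∀ j, ContMDiffOn ((𝓡∂ n).prod (𝓡∂ n)) 𝓘(ℝ, ℂ) ∞ (fun p : M × M => q j p.1 p.2)
    ((𝓡∂ n).interior M ×ˢ (𝓡∂ n).interior M)
  mul_continuous : ∀ x j, ∃ m : testSpace L →ₗ[ℂ] testSpace L,
    (∀ φ, (m φ : Lp ℂ 2 μ) =ᵐ[μ] fun y => q j x y * (φ : Lp ℂ 2 μ) y) ∧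
    ∀ k, ∃ (c : ℝ) (k' : ℕ), ∀ φ, testNorm L k (m φ) ≤ c * testNorm L k' φ
  diagonal : ∀ x j, q j x x = 0
  rank : ∀ x ∈ (𝓡∂ n).interior M, 
    Module.finrank ℂ (Submodule.span ℂ (Set.range fun j => differential n (q j x) x)) = n
  eq_of_zero : ∀ x y, (∀ j, q j x y = 0) → x = y

/-- The Taylor operators `D^{(α)}` of a collection `q`: `D^{(0)} = I`, and for every smooth `g`, every
interior point `e` and every `i`, all derivatives of order `i` in local coordinates satisfy
`∂^β g(e) = ∑_{|α| ≤ i} (1/α!) ∂^β_x q^α(e, x)|_{x = e} D^{(α)} g(e)`, where `|β| = i`. -/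
structure IsTaylorFamily (n : ℕ) [NeZero n] {M : Type*} [TopologicalSpace M]
    [ChartedSpace (EuclideanHalfSpace n) M] {l : ℕ} (q : Fin l → M → M → ℂ)
    (D : (Fin l → ℕ) → (M → ℂ) → M → ℂ) : Prop where
  zero : ∀ g, D 0 g = g
  recurrence : ∀ g : M → ℂ, ContMDiff (𝓡∂ n) 𝓘(ℝ, ℂ) ∞ g → ∀ e ∈ (𝓡∂ n).interior M, ∀ i : ℕ,
    iteratedFDeriv ℝ i (fun z =>
      g ((extChartAt (𝓡∂ n) e).symm z) -
        ∑ k ∈ Finset.range (i + 1), ∑ α ∈ Finset.piAntidiag (Finset.univ : Finset (Fin l)) k,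
          (∏ j, ((α j).factorial : ℂ))⁻¹ * D α g e *
            qPow q α e ((extChartAt (𝓡∂ n) e).symm z))
      (extChartAt (𝓡∂ n) e e) = 0

/-- The symbol class `S^m_{ρ,δ}(M × I)`: functions smooth in `x` with
`|Δ^α_{(x)} D^{(β)}_x a(x, ξ)| ≤ C_{αβ} ⟨ξ⟩^{m - ρ|α| + δ|β|}` in the interior, for some `L`-strongly
admissible collection and its Taylor operators; the estimate for `α = β = 0`, where
`Δ⁰ D⁰ a = a`, is asked for on all of `M`. -/
structure SymbolClass (n : ℕ) [NeZero n] {M : Type*} [TopologicalSpace M]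
    [ChartedSpace (EuclideanHalfSpace n) M] [MeasurableSpace M] {μ : Measure M}
    {L : Lp ℂ 2 μ →ₗ.[ℂ] Lp ℂ 2 μ} {ι : Type*} (S : EigenSystem μ L ι) (ν m ρ δ : ℝ)
    (a : M → ι → ℂ) : Prop where
  smooth : ∀ ξ, ContMDiff (𝓡∂ n) 𝓘(ℝ, ℂ) ∞ fun x => a x ξ
  order : ∃ C : ℝ, ∀ x ξ, ‖a x ξ‖ ≤ C * S.weight ν ξ ^ m
  estimate : ∃ (l : ℕ) (q : Fin l → M → M → ℂ) (D : (Fin l → ℕ) → (M → ℂ) → M → ℂ),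
    StronglyAdmissible n L q ∧ IsTaylorFamily n q D ∧
    ∀ α β : Fin l → ℕ, ∃ C : ℝ, ∀ x ∈ (𝓡∂ n).interior M, ∀ ξ,
      ‖difference S q α (fun y η => D β (fun z => a z η) y) x ξ‖ ≤
        C * S.weight ν ξ ^ (m - ρ * (∑ j, α j : ℕ) + δ * (∑ j, β j : ℕ))

end Manifold

/-- Two-sided bound on a set of parameters: `c g ≤ f ≤ C g` with positive constants `c, C`. -/
def TwoSided (f g : ℝ → ℝ) (s : Set ℝ) : Prop :=
  ∃ c C : ℝ, 0 < c ∧ 0 < C ∧ ∀ t ∈ s, c * g t ≤ f t ∧ f t ≤ C * g t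

/-- `∫_{t^{1/q}}^∞ e^{-s^q} s^{a - 1} ds`. -/
def heatIntegral (q a t : ℝ) : ℝ :=
  ∫ s in Ioi (t ^ (1 / q)), Real.exp (-s ^ q) * s ^ (a - 1)

end NonHarmonic

end

/-!
The trace is diagonal in the eigenbasis. By continuity of `A` and rapid convergence of eigenfunction
expansions of `exp(-t M_q) f` in `C^∞_L`, the composition `A exp(-t M_q)` is
`∑_ξ exp(-t ⟨ξ⟩^q) ⟨·, u_ξ⟩ σ(·, ξ) u_ξ` (`EigenSystem.hasSum_apply`,
`EigenSystem.WeylLaw.hasHeatTrace`). Since `‖σ(·, ξ) u_ξ‖` is `O(⟨ξ⟩^m)`, this sum of rank one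
operators converges absolutely, and its trace is `∑_ξ g_ξ exp(-t ⟨ξ⟩^q)` with
`g_ξ = ∫ σ(x, ξ) |u_ξ(x)|² dx` (`hasTrace_of_hasSum`). Positivity, the order of the symbol and
ellipticity give `g_ξ ≥ 0`, `g_ξ ≤ C ⟨ξ⟩^m`, and `g_ξ ≥ c ⟨ξ⟩^m` for large `⟨ξ⟩`.

The trace is thus the Laplace transform, in the variable `r^q`, of the measure `∑ g_ξ δ_{⟨ξ⟩}` on
`[1, ∞)`. By the Weyl law this measure and `r^{Q+m-1} dr` on `(1, ∞)` both give a mass of order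
`B^{k(Q+m)}` to the late blocks `(B^{k-1}, B^k]` of a large ratio `B`, and at most such a mass to all
blocks. Both Laplace transforms are therefore comparable with
`∑_k exp(-t B^{kq}) B^{k(Q+m)}`, uniformly for bounded `t` (`lintegral_le_mul_lintegral`,
`twoSided_tsum`), and the substitution `s = t^{1/q} r` turns the second one into
`t^{-(Q+m)/q} ∫_{t^{1/q}}^∞ exp(-s^q) s^{Q+m-1} ds`.

The remaining assertions concern this incomplete Gamma integral: its logarithmic growth for
`Q + m = 0` (`twoSided_heatIntegral_zero`), and for `Q + m > 0` its expansion by termwise integration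
of the exponential series over `(0, t^{1/q}]` (`hasSum_heatIntegral`, `exists_coefficients`).
-/

namespace NonHarmonic

/-! ### Traces of absolutely convergent sums of rank one operators -/

section Trace

variable {E : Type*} [NormedAddCommGroup E] [InnerProductSpace ℂ E] {ι : Type*}

theorem exists_hasSum_rankOne [CompleteSpace E] {x y : ι → E}
    (h : Summable fun i => ‖x i‖ * ‖y i‖) :
    ∃ T : E →L[ℂ] E, ∀ f, HasSum (fun i => inner ℂ (y i) f • x i) (T f) := by
  have hs : Summable fun i => (innerSL ℂ (y i)).smulRight (x i) := by
    refine Summable.of_norm ?_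
    simpa [ContinuousLinearMap.norm_smulRight_apply, mul_comm] using h
  refine ⟨∑' i, (innerSL ℂ (y i)).smulRight (x i), fun f => ?_⟩
  simpa using hs.hasSum.mapL (ContinuousLinearMap.apply ℂ E f)

theorem isTraceClass_of_hasSum [Countable ι] {x y : ι → E} {T : E →L[ℂ] E}
    (h : Summable fun i => ‖x i‖ * ‖y i‖)
    (hT : ∀ f, HasSum (fun i => inner ℂ (y i) f • x i) (T f)) : IsTraceClass T := by
  obtain ⟨e, he⟩ := exists_injective_nat ι
  refine ⟨Function.extend e x 0, Function.extend e y 0, ?_, fun f => ?_⟩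
  · refine (he.summable_iff fun k hk => ?_).1 (h.congr fun i => ?_)
    · simp [Function.extend_apply' x (0 : ℕ → E) k (by simpa using hk)]
    · simp [he.extend_apply]
  · refine (he.hasSum_iff fun k hk => ?_).1 ((hT f).congr_fun fun i => ?_)
    · simp [Function.extend_apply' x (0 : ℕ → E) k (by simpa using hk)]
    · simp [he.extend_apply]

theorem summable_norm_inner_mul_inner {κ : Type*} (b : HilbertBasis κ ℂ E) (x y : E) :
    (Summable fun i => ‖inner ℂ (b i) x‖ * ‖inner ℂ (b i) y‖) ∧
      ∑' i, ‖inner ℂ (b i) x‖ * ‖inner ℂ (b i) y‖ ≤ ‖x‖ * ‖y‖ := by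
  have hb (s : Finset κ) (z : E) : √(∑ i ∈ s, ‖inner ℂ (b i) z‖ ^ 2) ≤ ‖z‖ :=
    Real.sqrt_le_iff.2 ⟨norm_nonneg z, b.orthonormal.sum_inner_products_le z⟩
  have h (s : Finset κ) : ∑ i ∈ s, ‖inner ℂ (b i) x‖ * ‖inner ℂ (b i) y‖ ≤ ‖x‖ * ‖y‖ :=
    (Real.sum_mul_le_sqrt_mul_sqrt s _ _).trans
      (mul_le_mul (hb s x) (hb s y) (Real.sqrt_nonneg _) (norm_nonneg x))
  have h0 (i : κ) : 0 ≤ ‖inner ℂ (b i) x‖ * ‖inner ℂ (b i) y‖ := by positivity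
  exact ⟨summable_of_sum_le h0 h, Real.tsum_le_of_sum_le h0 h⟩

/-- The trace of `∑ᵢ ⟨·, yᵢ⟩ xᵢ` is `∑ᵢ ⟨yᵢ, xᵢ⟩` in every orthonormal basis: by Bessel's
inequality the double series over `i` and the basis converges absolutely. -/
theorem hasTrace_of_hasSum [Countable ι] {x y : ι → E} {T : E →L[ℂ] E}
    (h : Summable fun i => ‖x i‖ * ‖y i‖)
    (hT : ∀ f, HasSum (fun i => inner ℂ (y i) f • x i) (T f)) :
    HasTrace T (∑' i, inner ℂ (y i) (x i)) := by
  refine ⟨isTraceClass_of_hasSum h hT, fun s b => ?_⟩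
  have hs : Summable fun p : ι × s => inner ℂ (y p.1) (b p.2) * inner ℂ (b p.2) (x p.1) := by
    refine Summable.of_norm ?_
    refine (summable_prod_of_nonneg fun p => norm_nonneg _).2 ⟨fun i => ?_, ?_⟩
    · refine (summable_norm_inner_mul_inner b (y i) (x i)).1.congr fun k => ?_
      simp [norm_inner_symm (y i)]
    · refine h.of_nonneg_of_le (fun i => tsum_nonneg fun _ => norm_nonneg _) fun i => ?_
      refine (le_of_eq (tsum_congr fun k => ?_)).trans
        (summable_norm_inner_mul_inner b (x i) (y i)).2
      simp [norm_inner_symm (y i), mul_comm]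
  have h1 (i : ι) : HasSum (fun k => inner ℂ (y i) (b k) * inner ℂ (b k) (x i))
      (inner ℂ (y i) (x i)) := b.hasSum_inner_mul_inner _ _
  have h2 (k : s) : HasSum (fun i => inner ℂ (y i) (b k) * inner ℂ (b k) (x i))
      (inner ℂ (b k) (T (b k))) := by
    simpa [inner_smul_right] using (hT (b k)).mapL (innerSL ℂ (b k))
  have h3 := (((Equiv.prodComm s ι).hasSum_iff.2 hs.hasSum)).prod_fiberwise h2
  rwa [(hs.hasSum.prod_fiberwise h1).tsum_eq]

end Trace

/-! ### Eigenfunction expansions in the space of test functions -/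

section Expansion

variable {M : Type*} [MeasurableSpace M] {μ : Measure M}
  {L : Lp ℂ 2 μ →ₗ.[ℂ] Lp ℂ 2 μ} {ι : Type*}

theorem EigenSystem.testMap_pow_basis (S : EigenSystem μ L ι) (j : ℕ) (ξ : ι) :
    ((testMap L) ^ j) ⟨S.basis ξ, S.mem_testSpace ξ⟩ =
      S.ev ξ ^ j • ⟨S.basis ξ, S.mem_testSpace ξ⟩ := by
  induction j with
  | zero => simp
  | succ j ih =>
    have h : testMap L ⟨S.basis ξ, S.mem_testSpace ξ⟩ =
        S.ev ξ • ⟨S.basis ξ, S.mem_testSpace ξ⟩ := Subtype.ext (S.apply_eq ξ)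
    rw [pow_succ, Module.End.mul_apply, h, map_smul, ih, smul_smul, pow_succ']

/-- A closed operator may be applied termwise to an eigenfunction expansion if the resulting
series converges. -/
theorem EigenSystem.apply_hasSum (S : EigenSystem μ L ι) (hL : L.IsClosed) {c : ι → ℂ}
    {g h : Lp ℂ 2 μ} (hg : HasSum (fun ξ => c ξ • S.basis ξ) g)
    (hh : HasSum (fun ξ => (S.ev ξ * c ξ) • S.basis ξ) h) :
    ∃ hd : g ∈ L.domain, L ⟨g, hd⟩ = h := by
  have hmem : (g, h) ∈ L.graph := by
    refine hL.mem_of_tendsto (hg.prodMk_nhds hh) (Eventually.of_forall fun s => ?_)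
    refine (LinearPMap.mem_graph_iff L).2
      ⟨∑ ξ ∈ s, c ξ • ⟨S.basis ξ, S.mem_domain ξ⟩, by simp, ?_⟩
    rw [← LinearPMap.toFun_eq_coe, map_sum]
    refine Finset.sum_congr rfl fun ξ _ => ?_
    rw [map_smul, LinearPMap.toFun_eq_coe, S.apply_eq, smul_smul, mul_comm]
  obtain ⟨y, hy, hy'⟩ := (LinearPMap.mem_graph_iff L).1 hmem
  simp only at hy hy'
  subst hy
  exact ⟨y.2, hy'⟩

theorem EigenSystem.summable_smul_basis (S : EigenSystem μ L ι) {c : ι → ℂ}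
    (hc : Summable fun ξ => ‖c ξ‖) : Summable fun ξ => c ξ • S.basis ξ := by
  refine Summable.of_norm (hc.congr fun ξ => ?_)
  rw [norm_smul, S.basis.orthonormal.1, mul_one]

/-- An expansion with coefficients that decay rapidly with respect to the eigenvalues is a test
function. -/
theorem EigenSystem.mem_testSpace_of_hasSum (S : EigenSystem μ L ι) (hL : L.IsClosed) {c : ι → ℂ}
    (hc : ∀ j : ℕ, Summable fun ξ => ‖S.ev ξ ^ j * c ξ‖)
    {g : Lp ℂ 2 μ} (hg : HasSum (fun ξ => c ξ • S.basis ξ) g) : g ∈ testSpace L := by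
  refine (Submodule.mem_iInf _).2 fun k => ?_
  induction k generalizing c g with
  | zero => exact Submodule.mem_top
  | succ k ih =>
    have h1 := (S.summable_smul_basis (hc 1)).hasSum
    simp only [pow_one] at h1
    obtain ⟨hd, hd'⟩ := S.apply_hasSum hL hg h1
    refine mem_domPow_succ.2 ⟨hd, ?_⟩
    rw [hd']
    refine ih (fun j => ?_) h1
    simpa only [pow_succ, mul_assoc] using hc (j + 1)

theorem EigenSystem.hasSum_testMap_pow (S : EigenSystem μ L ι) (hL : L.IsClosed) {c : ι → ℂ}
    (hc : ∀ j : ℕ, Summable fun ξ => ‖S.ev ξ ^ j * c ξ‖)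
    (g : testSpace L) (hg : HasSum (fun ξ => c ξ • S.basis ξ) (g : Lp ℂ 2 μ)) (j : ℕ) :
    HasSum (fun ξ => (S.ev ξ ^ j * c ξ) • S.basis ξ)
      (((testMap L ^ j) g : testSpace L) : Lp ℂ 2 μ) := by
  induction j with
  | zero => simpa using hg
  | succ j ih =>
    have h1 := (S.summable_smul_basis (hc (j + 1))).hasSum
    simp only [pow_succ', mul_assoc] at h1
    obtain ⟨hd, hd'⟩ := S.apply_hasSum hL ih h1
    simp only [pow_succ', mul_assoc, Module.End.mul_apply]
    have : (testMap L ((testMap L ^ j) g) : Lp ℂ 2 μ) = L ⟨_, hd⟩ := rfl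
    rwa [this, hd']

/-- A continuous operator `C^∞_L → D'_L` may be applied termwise to a rapidly converging
eigenfunction expansion, since the latter converges in all the norms of `C^∞_L`. -/
theorem EigenSystem.hasSum_apply (S : EigenSystem μ L ι) (hL : L.IsClosed)
    {A : testSpace L →ₗ[ℂ] LDistribution L} (hA : IsContinuousOperator L A) {c : ι → ℂ}
    (hc : ∀ j : ℕ, Summable fun ξ => ‖S.ev ξ ^ j * c ξ‖)
    (g : testSpace L) (hg : HasSum (fun ξ => c ξ • S.basis ξ) (g : Lp ℂ 2 μ))
    (φ : testSpace L.adjoint) :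
    HasSum (fun ξ => c ξ * (A ⟨S.basis ξ, S.mem_testSpace ξ⟩ : testSpace L.adjoint →ₗ[ℂ] ℂ) φ)
      ((A g : testSpace L.adjoint →ₗ[ℂ] ℂ) φ) := by
  obtain ⟨d, k, hd⟩ := hA φ
  set u : ι → testSpace L := fun ξ => ⟨S.basis ξ, S.mem_testSpace ξ⟩ with hu
  set r : Finset ι → testSpace L := fun s => g - ∑ ξ ∈ s, c ξ • u ξ with hr
  have hj (j : ℕ) : Tendsto (fun s => ‖(((testMap L) ^ j) (r s) : Lp ℂ 2 μ)‖) atTop (𝓝 0) := by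
    have h1 := S.hasSum_testMap_pow hL hc g hg j
    have h2 := (tendsto_const_nhds (x := (((testMap L ^ j) g : testSpace L) : Lp ℂ 2 μ))).sub h1
    rw [sub_self] at h2
    refine (tendsto_zero_iff_norm_tendsto_zero.1 h2).congr fun s => ?_
    congr 1
    simp only [hr, map_sub, map_sum, map_smul, hu, S.testMap_pow_basis, smul_smul,
      AddSubgroupClass.coe_sub, AddSubmonoidClass.coe_finsetSum, SetLike.val_smul, mul_comm]
  have hk : Tendsto (fun s => testNorm L k (r s)) atTop (𝓝 0) := by
    have h3 := tendsto_finsetSum (Finset.range (k + 1)) fun j _ => hj j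
    rw [Finset.sum_const_zero] at h3
    refine squeeze_zero (fun s => testNorm_nonneg L k _) (fun s => ?_) h3
    refine Finset.sup'_le _ _ fun j hj => ?_
    exact Finset.single_le_sum (f := fun j => ‖(((testMap L) ^ j) (r s) : Lp ℂ 2 μ)‖)
      (fun _ _ => norm_nonneg _) hj
  have h4 : Tendsto (fun s => (A (r s) : testSpace L.adjoint →ₗ[ℂ] ℂ) φ) atTop (𝓝 0) := by
    refine squeeze_zero_norm (fun s => hd (r s)) ?_
    simpa using hk.const_mul d
  have h5 := (tendsto_const_nhds (x := (A g : testSpace L.adjoint →ₗ[ℂ] ℂ) φ)).sub h4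
  rw [sub_zero] at h5
  refine h5.congr fun s => ?_
  simp [hr]
  rfl

end Expansion

/-! ### Laplace transforms and geometric blocks -/

section Blocks

open scoped ENNReal NNReal

/-- The model sum `∑ₖ exp(-t B^{kq}) B^{ka}` over a geometric progression. -/
noncomputable def blockSum (B q a t : ℝ) : ℝ≥0∞ :=
  ∑' k : ℕ, ENNReal.ofReal (Real.exp (-t * (B ^ k) ^ q) * (B ^ k) ^ a)

theorem mem_iUnion_block {B : ℝ} (hB : 1 < B) {r : ℝ} (hr : 1 ≤ r) :
    r ∈ ⋃ k : ℕ, Ioc (B ^ k / B) (B ^ k) := by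
  have hB0 : 0 < B := by linarith
  have h : ∃ k : ℕ, r ≤ B ^ k := ((pow_unbounded_of_one_lt r hB).imp fun _ h => h.le)
  classical
  refine mem_iUnion.2 ⟨Nat.find h, ?_, Nat.find_spec h⟩
  rcases hk : Nat.find h with _ | k
  · rw [pow_zero]
    exact (((div_lt_one hB0).2 hB).trans_le hr : 1 / B < r)
  · rw [pow_succ, mul_div_cancel_right₀ _ hB0.ne']
    exact not_le.1 (Nat.find_min h (by omega))

theorem pairwise_disjoint_block {B : ℝ} (hB : 1 < B) :
    Pairwise (Function.onFun Disjoint fun k : ℕ => Ioc (B ^ k / B) (B ^ k)) := by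
  have hB0 : 0 < B := by linarith
  have hm : Monotone fun k : ℕ => B ^ k / B := fun k l h =>
    div_le_div_of_nonneg_right (pow_le_pow_right₀ hB.le h) hB0.le
  have := hm.pairwise_disjoint_on_Ioc_succ
  simpa [pow_succ, mul_div_cancel_right₀ _ hB0.ne'] using this

/-- On a block `(x / B, x]` a power function is constant up to a factor. -/
theorem rpow_le_of_mem_block {B x r p : ℝ} (hB : 1 < B) (hr : r ∈ Ioc (x / B) x) (hx : 0 < x) :
    r ^ p ≤ B ^ |p| * x ^ p ∧ x ^ p ≤ B ^ |p| * r ^ p := by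
  have hB0 : 0 < B := by linarith
  have hr0 : 0 < r := (div_pos hx hB0).trans hr.1
  have h1 : 1 ≤ B ^ |p| := Real.one_le_rpow hB.le (abs_nonneg p)
  have h2 : x ≤ B * r := by
    have := (div_lt_iff₀ hB0).1 hr.1
    linarith
  have hxp := Real.rpow_pos_of_pos hx p
  have hrp := Real.rpow_pos_of_pos hr0 p
  rcases le_total 0 p with hp | hp
  · rw [abs_of_nonneg hp] at *
    refine ⟨?_, ?_⟩
    · exact (Real.rpow_le_rpow hr0.le hr.2 hp).trans (le_mul_of_one_le_left hxp.le h1)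
    · rw [← Real.mul_rpow hB0.le hr0.le]
      exact Real.rpow_le_rpow hx.le h2 hp
  · rw [abs_of_nonpos hp] at *
    refine ⟨?_, ?_⟩
    · have h3 := Real.rpow_le_rpow_of_nonpos hx h2 hp
      rw [Real.mul_rpow hB0.le hr0.le] at h3
      have h4 : B ^ (-p) * B ^ p = 1 := by rw [← Real.rpow_add hB0]; simp
      calc r ^ p = B ^ (-p) * (B ^ p * r ^ p) := by rw [← mul_assoc, h4, one_mul]
        _ ≤ _ := mul_le_mul_of_nonneg_left h3 (by positivity)
    · exact (Real.rpow_le_rpow_of_nonpos hr0 hr.2 hp).trans (le_mul_of_one_le_left hrp.le h1)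

variable {B q a T : ℝ}

/-- If every block `(B^{k-1}, B^k]` has mass at most a multiple of `B^{ka}`, the Laplace transform is
bounded by the model sum: block `k + 1` is compared with the term of index `k`. -/
theorem lintegral_le_blockSum (hB : 1 < B) (hq : 0 < q) {κ : Measure ℝ} (h0 : κ (Iio 1) = 0)
    {C : ℝ≥0} (hC : ∀ k : ℕ, κ (Ioc (B ^ k / B) (B ^ k)) ≤ C * ENNReal.ofReal ((B ^ k) ^ a)) :
    ∃ C' : ℝ≥0, ∀ t ∈ Ioc 0 T,
      ∫⁻ r, ENNReal.ofReal (Real.exp (-t * r ^ q)) ∂κ ≤ C' * blockSum B q a t := by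
  have hB0 : 0 < B := by linarith
  -- The first block, of mass at most `C`, is compared with the first term `exp(-t) ≥ exp(-T)`; the
  -- factor `B^a` comes from the shift of the index in the other blocks.
  refine ⟨C * (Real.exp T).toNNReal + C * (B ^ a).toNNReal, fun t ht => ?_⟩
  have hae : ∀ᵐ r ∂κ, r ∈ ⋃ k : ℕ, Ioc (B ^ k / B) (B ^ k) := by
    refine measure_mono_null (fun r hr => ?_) h0
    by_contra h
    exact hr (mem_iUnion_block hB (not_lt.1 h))
  rw [← Measure.restrict_eq_self_of_ae_mem hae,
    lintegral_iUnion (fun k => measurableSet_Ioc) (pairwise_disjoint_block hB)]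
  have hk (k : ℕ) : ∫⁻ r in Ioc (B ^ k / B) (B ^ k), ENNReal.ofReal (Real.exp (-t * r ^ q)) ∂κ ≤
      ENNReal.ofReal (Real.exp (-t * (B ^ k / B) ^ q)) * (C * ENNReal.ofReal ((B ^ k) ^ a)) := by
    calc _ ≤ ∫⁻ r in Ioc (B ^ k / B) (B ^ k),
          ENNReal.ofReal (Real.exp (-t * (B ^ k / B) ^ q)) ∂κ := by
          refine setLIntegral_mono measurable_const fun r hr => ?_
          refine ENNReal.ofReal_le_ofReal (Real.exp_le_exp.2 ?_)
          have := Real.rpow_le_rpow (by positivity) hr.1.le hq.le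
          nlinarith [ht.1]
      _ ≤ _ := by
          rw [setLIntegral_const]
          gcongr
          exact hC k
  refine (ENNReal.tsum_le_tsum hk).trans ?_
  rw [tsum_eq_zero_add' ENNReal.summable, ENNReal.coe_add, add_mul]
  refine add_le_add ?_ ?_
  · have h1 : (1 : ℝ≥0∞) ≤ (Real.exp T).toNNReal * blockSum B q a t := by
      have h2 : ENNReal.ofReal (Real.exp (-t * (B ^ 0) ^ q) * (B ^ 0) ^ a) ≤ blockSum B q a t :=
        ENNReal.le_tsum (f := fun k : ℕ =>
          ENNReal.ofReal (Real.exp (-t * (B ^ k) ^ q) * (B ^ k) ^ a)) 0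
      refine le_trans ?_ (mul_le_mul_right h2 _)
      rw [show ((Real.exp T).toNNReal : ℝ≥0∞) = ENNReal.ofReal (Real.exp T) from rfl,
        ← ENNReal.ofReal_mul (Real.exp_pos T).le]
      refine ENNReal.one_le_ofReal.2 ?_
      simp only [pow_zero, Real.one_rpow, mul_one, ← Real.exp_add]
      exact Real.one_le_exp (by linarith [ht.2])
    calc _ ≤ 1 * (C * ENNReal.ofReal ((B ^ 0) ^ a)) := by
          gcongr
          refine ENNReal.ofReal_le_one.2 (Real.exp_le_one_iff.2 ?_)
          have : (0 : ℝ) ≤ (B ^ 0 / B) ^ q := by positivity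
          nlinarith [ht.1]
      _ = C * 1 := by simp
      _ ≤ _ := by
          rw [ENNReal.coe_mul, mul_assoc]
          gcongr
  · rw [blockSum, ← ENNReal.tsum_mul_left]
    refine ENNReal.tsum_le_tsum fun k => le_of_eq ?_
    rw [pow_succ, mul_div_cancel_right₀ _ hB0.ne', Real.mul_rpow (by positivity) hB0.le,
      ENNReal.ofReal_mul (by positivity), ENNReal.ofReal_mul (by positivity), ENNReal.coe_mul]
    change _ = C * ENNReal.ofReal (B ^ a) * _
    ring

/-- The finitely many initial terms of the model sum are dominated by any later one, uniformly for
bounded parameters. -/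
theorem blockSum_le_tsum_add (hB : 1 < B) (K : ℕ) :
    ∃ C' : ℝ≥0, ∀ t ∈ Ioc 0 T, blockSum B q a t ≤
      C' * ∑' k : ℕ, ENNReal.ofReal (Real.exp (-t * (B ^ (k + K)) ^ q) * (B ^ (k + K)) ^ a) := by
  have hB0 : 0 < B := by linarith
  set d : ℝ := Real.exp (-T * (B ^ K) ^ q) * (B ^ K) ^ a with hd
  have hd0 : 0 < d := by positivity
  refine ⟨(∑ k ∈ Finset.range K, ((B ^ k) ^ a / d).toNNReal) + 1, fun t ht => ?_⟩
  rw [blockSum, ← Summable.sum_add_tsum_nat_add' (k := K) ENNReal.summable, ENNReal.coe_add,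
    add_mul, ENNReal.coe_one, one_mul]
  refine add_le_add ?_ le_rfl
  rw [ENNReal.ofNNReal_finsetSum, Finset.sum_mul]
  refine Finset.sum_le_sum fun k _ => ?_
  have h0 := ENNReal.le_tsum (f := fun k : ℕ =>
    ENNReal.ofReal (Real.exp (-t * (B ^ (k + K)) ^ q) * (B ^ (k + K)) ^ a)) 0
  rw [zero_add] at h0
  refine le_trans ?_ (mul_le_mul_right h0 _)
  rw [show (((B ^ k) ^ a / d).toNNReal : ℝ≥0∞) = ENNReal.ofReal ((B ^ k) ^ a / d) from rfl,
    ← ENNReal.ofReal_mul (by positivity)]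
  refine ENNReal.ofReal_le_ofReal ?_
  have h1 : d ≤ Real.exp (-t * (B ^ K) ^ q) * (B ^ K) ^ a := by
    rw [hd]
    gcongr
    exact ht.2
  have h2 : Real.exp (-t * (B ^ k) ^ q) ≤ 1 := by
    refine Real.exp_le_one_iff.2 ?_
    have : (0 : ℝ) ≤ (B ^ k) ^ q := by positivity
    nlinarith [ht.1]
  calc Real.exp (-t * (B ^ k) ^ q) * (B ^ k) ^ a ≤ 1 * (B ^ k) ^ a := by gcongr
    _ = (B ^ k) ^ a / d * d := by field_simp
    _ ≤ _ := by gcongr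

/-- If all late blocks `(B^{k-1}, B^k]` have mass at least a multiple of `B^{ka}`, the Laplace
transform dominates the model sum. -/
theorem blockSum_le_lintegral (hB : 1 < B) (hq : 0 < q) {κ : Measure ℝ} {C : ℝ≥0} {K : ℕ}
    (hC : ∀ k : ℕ, K ≤ k → ENNReal.ofReal ((B ^ k) ^ a) ≤ C * κ (Ioc (B ^ k / B) (B ^ k))) :
    ∃ C' : ℝ≥0, ∀ t ∈ Ioc 0 T,
      blockSum B q a t ≤ C' * ∫⁻ r, ENNReal.ofReal (Real.exp (-t * r ^ q)) ∂κ := by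
  have hB0 : 0 < B := by linarith
  obtain ⟨C₁, hC₁⟩ := blockSum_le_tsum_add (q := q) (a := a) (T := T) hB K
  refine ⟨C₁ * C, fun t ht => (hC₁ t ht).trans ?_⟩
  rw [ENNReal.coe_mul, mul_assoc]
  gcongr
  have h1 : ∑' k : ℕ, ∫⁻ r in Ioc (B ^ (k + K) / B) (B ^ (k + K)),
      ENNReal.ofReal (Real.exp (-t * r ^ q)) ∂κ ≤
      ∫⁻ r, ENNReal.ofReal (Real.exp (-t * r ^ q)) ∂κ := by
    rw [← lintegral_iUnion (fun k => measurableSet_Ioc)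
      ((pairwise_disjoint_block hB).comp_of_injective (add_left_injective K))]
    exact lintegral_mono' Measure.restrict_le_self le_rfl
  refine le_trans ?_ (mul_le_mul_right h1 _)
  rw [← ENNReal.tsum_mul_left]
  refine ENNReal.tsum_le_tsum fun k => ?_
  rw [ENNReal.ofReal_mul (Real.exp_pos _).le]
  calc _ ≤ ENNReal.ofReal (Real.exp (-t * (B ^ (k + K)) ^ q)) *
        (C * κ (Ioc (B ^ (k + K) / B) (B ^ (k + K)))) := by
        gcongr
        exact hC _ (by omega)
    _ = C * ∫⁻ r in Ioc (B ^ (k + K) / B) (B ^ (k + K)),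
        ENNReal.ofReal (Real.exp (-t * (B ^ (k + K)) ^ q)) ∂κ := by
        rw [setLIntegral_const]
        ring
    _ ≤ _ := by
        refine mul_le_mul_right (setLIntegral_mono' measurableSet_Ioc fun r hr => ?_) _
        refine ENNReal.ofReal_le_ofReal (Real.exp_le_exp.2 ?_)
        have h2 : 0 ≤ r := (by positivity : (0 : ℝ) ≤ B ^ (k + K) / B).trans hr.1.le
        have := Real.rpow_le_rpow h2 hr.2 hq.le
        nlinarith [ht.1]

/-- Laplace transforms of measures on `[1, ∞)` are comparable for bounded parameters when the masses
of the geometric blocks are. -/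
theorem lintegral_le_mul_lintegral (hB : 1 < B) (hq : 0 < q) {κ κ' : Measure ℝ}
    (h0 : κ (Iio 1) = 0) {C C' : ℝ≥0} {K : ℕ}
    (hC : ∀ k : ℕ, κ (Ioc (B ^ k / B) (B ^ k)) ≤ C * ENNReal.ofReal ((B ^ k) ^ a))
    (hC' : ∀ k : ℕ, K ≤ k → ENNReal.ofReal ((B ^ k) ^ a) ≤ C' * κ' (Ioc (B ^ k / B) (B ^ k))) :
    ∃ c : ℝ≥0, ∀ t ∈ Ioc 0 T, ∫⁻ r, ENNReal.ofReal (Real.exp (-t * r ^ q)) ∂κ ≤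
      c * ∫⁻ r, ENNReal.ofReal (Real.exp (-t * r ^ q)) ∂κ' := by
  obtain ⟨c₁, h₁⟩ := lintegral_le_blockSum (T := T) hB hq h0 hC
  obtain ⟨c₂, h₂⟩ := blockSum_le_lintegral (T := T) hB hq hC'
  refine ⟨c₁ * c₂, fun t ht => (h₁ t ht).trans ?_⟩
  rw [ENNReal.coe_mul, mul_assoc]
  gcongr
  exact h₂ t ht

/-- The measure `r^{a - 1} dr` on `(1, ∞)`. -/
noncomputable def powerMeasure (a : ℝ) : Measure ℝ :=
  (volume.restrict (Ioi 1)).withDensity fun r => ENNReal.ofReal (r ^ (a - 1))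

theorem powerMeasure_Iio_one (a : ℝ) : powerMeasure a (Iio 1) = 0 := by
  refine withDensity_absolutelyContinuous _ _ ?_
  rw [Measure.restrict_apply measurableSet_Iio]
  refine (congrArg volume ?_).trans measure_empty
  ext r
  simp only [mem_inter_iff, mem_Iio, mem_Ioi, mem_empty_iff_false, iff_false]
  exact fun h => lt_asymm h.1 h.2

theorem lintegral_powerMeasure (t : ℝ) :
    ∫⁻ r, ENNReal.ofReal (Real.exp (-t * r ^ q)) ∂(powerMeasure a) =
      ∫⁻ r in Ioi 1, ENNReal.ofReal (Real.exp (-t * r ^ q) * r ^ (a - 1)) := by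
  rw [powerMeasure, lintegral_withDensity_eq_lintegral_mul _ (by fun_prop) (by fun_prop)]
  refine lintegral_congr fun r => ?_
  rw [Pi.mul_apply, ENNReal.ofReal_mul (Real.exp_pos _).le, mul_comm]

theorem powerMeasure_block_le (hB : 1 < B) :
    ∃ C : ℝ≥0, ∀ k : ℕ,
      powerMeasure a (Ioc (B ^ k / B) (B ^ k)) ≤ C * ENNReal.ofReal ((B ^ k) ^ a) := by
  have hB0 : 0 < B := by linarith
  refine ⟨(B ^ |a - 1|).toNNReal, fun k => ?_⟩
  have hk : 0 < B ^ k := by positivity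
  rw [powerMeasure, withDensity_apply _ measurableSet_Ioc]
  calc _ ≤ ∫⁻ r in Ioc (B ^ k / B) (B ^ k), ENNReal.ofReal (r ^ (a - 1)) := by
        refine lintegral_mono' ?_ le_rfl
        exact Measure.restrict_mono' (Eventually.of_forall fun _ h => h) Measure.restrict_le_self
    _ ≤ ∫⁻ r in Ioc (B ^ k / B) (B ^ k), ENNReal.ofReal (B ^ |a - 1| * (B ^ k) ^ (a - 1)) :=
        setLIntegral_mono measurable_const fun r hr =>
          ENNReal.ofReal_le_ofReal (rpow_le_of_mem_block hB hr hk).1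
    _ ≤ ENNReal.ofReal (B ^ |a - 1| * (B ^ k) ^ (a - 1)) * ENNReal.ofReal (B ^ k) := by
        rw [setLIntegral_const, Real.volume_Ioc]
        gcongr
        linarith [div_pos hk hB0]
    _ = _ := by
        change _ = ENNReal.ofReal _ * _
        rw [← ENNReal.ofReal_mul (by positivity), ← ENNReal.ofReal_mul (by positivity), mul_assoc,
          ← Real.rpow_add_one hk.ne', sub_add_cancel]

theorem le_powerMeasure_block (hB : 1 < B) :
    ∃ C : ℝ≥0, ∀ k : ℕ, 1 ≤ k →
      ENNReal.ofReal ((B ^ k) ^ a) ≤ C * powerMeasure a (Ioc (B ^ k / B) (B ^ k)) := by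
  have hB0 : 0 < B := by linarith
  have hb : 0 < 1 - 1 / B := by
    rw [sub_pos, div_lt_one hB0]
    exact hB
  refine ⟨(B ^ |a - 1| / (1 - 1 / B)).toNNReal, fun k hk1 => ?_⟩
  have hk : 0 < B ^ k := by positivity
  have hsub : Ioc (B ^ k / B) (B ^ k) ⊆ Ioi 1 := fun r hr => by
    refine lt_of_le_of_lt ?_ hr.1
    rw [le_div_iff₀ hB0, one_mul]
    exact le_self_pow₀ hB.le (by omega)
  rw [powerMeasure, withDensity_apply _ measurableSet_Ioc,
    Measure.restrict_restrict_of_subset hsub]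
  change _ ≤ ENNReal.ofReal _ * _
  rw [← lintegral_const_mul _ (by fun_prop)]
  calc ENNReal.ofReal ((B ^ k) ^ a)
      = ∫⁻ r in Ioc (B ^ k / B) (B ^ k),
          ENNReal.ofReal ((B ^ k) ^ (a - 1) / (1 - 1 / B)) := by
        rw [setLIntegral_const, Real.volume_Ioc, ← ENNReal.ofReal_mul (by positivity)]
        congr 1
        have : B ^ k - B ^ k / B = B ^ k * (1 - 1 / B) := by ring
        rw [this, Real.rpow_sub_one hk.ne', div_div, div_mul_cancel₀ _ (mul_pos hk hb).ne']
    _ ≤ _ := by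
        refine setLIntegral_mono (by fun_prop) fun r hr => ?_
        rw [← ENNReal.ofReal_mul (by positivity)]
        refine ENNReal.ofReal_le_ofReal ?_
        rw [div_mul_eq_mul_div]
        gcongr
        exact (rpow_le_of_mem_block hB hr hk).2

end Blocks

/-! ### The incomplete Gamma integral -/

section HeatIntegral

variable {q a t T : ℝ}

theorem integrableOn_exp_neg_rpow_mul_rpow_zero (hq : 0 < q) (ha : 0 < a) :
    IntegrableOn (fun s : ℝ => Real.exp (-s ^ q) * s ^ (a - 1)) (Ioi 0) := by
  simpa only [mul_comm] using integrableOn_rpow_mul_exp_neg_rpow (s := a - 1) (by linarith) hq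

theorem integrableOn_exp_neg_rpow_mul_rpow (hq : 0 < q) (a : ℝ) {c : ℝ} (hc : 0 < c) :
    IntegrableOn (fun s : ℝ => Real.exp (-s ^ q) * s ^ (a - 1)) (Ioi c) := by
  -- On `(c, ∞)` the power `s^{a-1}` is dominated by one that is integrable at `0`.
  set b : ℝ := |a| + 1 with hb
  have hab : a ≤ b := (le_abs_self a).trans (by linarith)
  have h1 : IntegrableOn (fun s : ℝ => c ^ (a - b) * (Real.exp (-s ^ q) * s ^ (b - 1))) (Ioi c) :=
    ((integrableOn_exp_neg_rpow_mul_rpow_zero hq (a := b) (by positivity)).mono_set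
      (Ioi_subset_Ioi hc.le)).const_mul _
  refine h1.mono' (by fun_prop) ?_
  refine (ae_restrict_iff' measurableSet_Ioi).2 (Eventually.of_forall fun s hs => ?_)
  have hs0 : 0 < s := hc.trans hs
  rw [Real.norm_of_nonneg (by positivity)]
  have h2 : s ^ (a - 1) = s ^ (a - b) * s ^ (b - 1) := by
    rw [← Real.rpow_add hs0]
    ring_nf
  have h3 : s ^ (a - b) ≤ c ^ (a - b) :=
    Real.rpow_le_rpow_of_nonpos hc (le_of_lt hs) (by linarith)
  rw [h2, mul_left_comm]
  gcongr

theorem rescaled_integrand (hq : 0 < q) (a : ℝ) (ht : 0 < t) {r : ℝ} (hr : 0 < r) :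
    Real.exp (-(t ^ (1 / q) * r) ^ q) * (t ^ (1 / q) * r) ^ (a - 1) =
      t ^ ((a - 1) / q) * (Real.exp (-t * r ^ q) * r ^ (a - 1)) := by
  rw [Real.mul_rpow (by positivity) hr.le, Real.mul_rpow (by positivity) hr.le,
    ← Real.rpow_mul ht.le, ← Real.rpow_mul ht.le, one_div_mul_cancel hq.ne', Real.rpow_one,
    one_div_mul_eq_div, neg_mul]
  ring

theorem integrableOn_exp_neg_mul_rpow_mul_rpow (hq : 0 < q) (a : ℝ) (ht : 0 < t) :
    IntegrableOn (fun r : ℝ => Real.exp (-t * r ^ q) * r ^ (a - 1)) (Ioi 1) := by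
  have hc : 0 < t ^ (1 / q) := by positivity
  have h1 := (integrableOn_Ioi_comp_mul_left_iff
    (fun s : ℝ => Real.exp (-s ^ q) * s ^ (a - 1)) 1 hc).2
    (integrableOn_exp_neg_rpow_mul_rpow hq a (by simpa using hc))
  have h2 : IntegrableOn
      (fun r : ℝ => t ^ ((a - 1) / q) * (Real.exp (-t * r ^ q) * r ^ (a - 1))) (Ioi 1) :=
    h1.congr_fun (fun r hr => rescaled_integrand hq a ht (zero_lt_one.trans hr)) measurableSet_Ioi
  exact (integrable_const_mul_iff (isUnit_iff_ne_zero.2 (by positivity)) _).1 h2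

theorem integral_Ioi_one_eq (hq : 0 < q) (a : ℝ) (ht : 0 < t) :
    ∫ r in Ioi 1, Real.exp (-t * r ^ q) * r ^ (a - 1) = t ^ (-(a / q)) * heatIntegral q a t := by
  have hc : 0 < t ^ (1 / q) := by positivity
  have h1 := integral_comp_mul_left_Ioi
    (fun s : ℝ => Real.exp (-s ^ q) * s ^ (a - 1)) 1 hc
  rw [setIntegral_congr_fun measurableSet_Ioi
    (fun r hr => rescaled_integrand hq a ht (zero_lt_one.trans hr)), integral_const_mul,
    mul_one, smul_eq_mul, ← Real.rpow_neg ht.le] at h1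
  rw [heatIntegral]
  have h2 : t ^ (-(a / q)) = t ^ (-((a - 1) / q)) * t ^ (-(1 / q)) := by
    rw [← Real.rpow_add ht]
    ring_nf
  rw [h2, mul_assoc, ← h1, ← mul_assoc, ← Real.rpow_add ht]
  simp

theorem heatIntegral_pos (hq : 0 < q) (a : ℝ) (ht : 0 < t) : 0 < heatIntegral q a t := by
  have hc : 0 < t ^ (1 / q) := by positivity
  rw [heatIntegral, setIntegral_pos_iff_support_of_nonneg_ae _
    (integrableOn_exp_neg_rpow_mul_rpow hq a hc)]
  · rw [inter_eq_right.2]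
    · simp
    · intro s hs
      have : 0 < s := hc.trans hs
      exact (by positivity : 0 < Real.exp (-s ^ q) * s ^ (a - 1)).ne'
  · refine (ae_restrict_iff' measurableSet_Ioi).2 (Eventually.of_forall fun s hs => ?_)
    have : 0 < s := hc.trans hs
    simp only [Pi.zero_apply]
    positivity

theorem heatIntegral_anti (hq : 0 < q) (a : ℝ) (ht : 0 < t) (htT : t ≤ T) :
    heatIntegral q a T ≤ heatIntegral q a t := by
  have hc : 0 < t ^ (1 / q) := by positivity
  refine setIntegral_mono_set (integrableOn_exp_neg_rpow_mul_rpow hq a hc) ?_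
    (Eventually.of_forall (Ioi_subset_Ioi (Real.rpow_le_rpow ht.le htT (by positivity))))
  refine (ae_restrict_iff' measurableSet_Ioi).2 (Eventually.of_forall fun s hs => ?_)
  have : 0 < s := hc.trans hs
  simp only [Pi.zero_apply]
  positivity

/-- In the critical case the integrand is `1/s` up to a bounded factor on `(t^{1/q}, 1]`, and the
rest of the integral is a constant. -/
theorem twoSided_heatIntegral_zero (hq : 0 < q) (hT : T < 1) :
    TwoSided (heatIntegral q 0) (fun t => -(1 / q * Real.log t)) (Ioc 0 T) := by
  set K : ℝ := ∫ s in Ioi 1, Real.exp (-s ^ q) * s ^ ((0 : ℝ) - 1) with hK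
  have hK0 : 0 ≤ K := setIntegral_nonneg measurableSet_Ioi fun s hs => by
    have : (0 : ℝ) < s := zero_lt_one.trans hs
    positivity
  rcases le_or_gt T 0 with hT0 | hT0
  · exact ⟨1, 1, one_pos, one_pos, fun t ht => absurd (ht.1.trans_le ht.2) (not_lt.2 hT0)⟩
  have hlT : 0 < -(1 / q * Real.log T) := by
    have := Real.log_neg hT0 hT
    rw [neg_pos]
    exact mul_neg_of_pos_of_neg (by positivity) this
  refine ⟨Real.exp (-1), 1 + K / (-(1 / q * Real.log T)), Real.exp_pos _, by positivity,
    fun t ht => ?_⟩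
  have hc : 0 < t ^ (1 / q) := Real.rpow_pos_of_pos ht.1 _
  have hc1 : t ^ (1 / q) ≤ 1 := Real.rpow_le_one ht.1.le (ht.2.trans hT.le) (by positivity)
  have hint := integrableOn_exp_neg_rpow_mul_rpow hq 0 hc
  have hsplit : heatIntegral q 0 t =
      (∫ s in Ioc (t ^ (1 / q)) 1, Real.exp (-s ^ q) * s ^ ((0 : ℝ) - 1)) + K := by
    rw [heatIntegral, hK, ← Ioc_union_Ioi_eq_Ioi hc1]
    rw [← Ioc_union_Ioi_eq_Ioi hc1] at hint
    exact setIntegral_union (Ioc_disjoint_Ioi le_rfl) measurableSet_Ioi hint.left_of_union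
      hint.right_of_union
  have hinv : IntegrableOn (fun s : ℝ => s⁻¹) (Ioc (t ^ (1 / q)) 1) := by
    rw [← intervalIntegrable_iff_integrableOn_Ioc_of_le hc1]
    refine intervalIntegral.intervalIntegrable_inv (fun s hs => ?_) continuousOn_id
    rw [uIcc_of_le hc1] at hs
    exact (hc.trans_le hs.1).ne'
  have hlog : ∫ s in Ioc (t ^ (1 / q)) 1, s⁻¹ = -(1 / q * Real.log t) := by
    rw [← intervalIntegral.integral_of_le hc1, integral_inv_of_pos hc one_pos, Real.log_div
      one_ne_zero hc.ne', Real.log_one, Real.log_rpow ht.1, zero_sub]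
  have hint' := hint.mono_set (t := Ioi (t ^ (1 / q))) (s := Ioc (t ^ (1 / q)) 1)
    Ioc_subset_Ioi_self
  have hpow (s : ℝ) (hs : s ∈ Ioc (t ^ (1 / q)) 1) : s ^ ((0 : ℝ) - 1) = s⁻¹ := by
    rw [zero_sub, Real.rpow_neg_one]
  have hlo : Real.exp (-1) * -(1 / q * Real.log t) ≤
      ∫ s in Ioc (t ^ (1 / q)) 1, Real.exp (-s ^ q) * s ^ ((0 : ℝ) - 1) := by
    rw [← hlog, ← integral_const_mul]
    refine setIntegral_mono_on (hinv.const_mul _) hint' measurableSet_Ioc fun s hs => ?_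
    have hs0 : 0 < s := hc.trans hs.1
    rw [hpow s hs]
    gcongr
    exact Real.rpow_le_one hs0.le hs.2 hq.le
  have hhi : ∫ s in Ioc (t ^ (1 / q)) 1, Real.exp (-s ^ q) * s ^ ((0 : ℝ) - 1) ≤
      -(1 / q * Real.log t) := by
    rw [← hlog]
    refine setIntegral_mono_on hint' hinv measurableSet_Ioc fun s hs => ?_
    have hs0 : 0 < s := hc.trans hs.1
    rw [hpow s hs]
    refine mul_le_of_le_one_left (by positivity) (Real.exp_le_one_iff.2 ?_)
    have := Real.rpow_nonneg hs0.le q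
    linarith
  have hmono : -(1 / q * Real.log T) ≤ -(1 / q * Real.log t) := by
    have := Real.log_le_log ht.1 ht.2
    gcongr
  refine ⟨by linarith, ?_⟩
  have h4 : K ≤ K / (-(1 / q * Real.log T)) * -(1 / q * Real.log t) := by
    rw [div_mul_eq_mul_div, le_div_iff₀ hlT]
    gcongr
  linarith

/-- The expansion of the lower incomplete Gamma integral, by termwise integration of the exponential
series. -/
theorem hasSum_integral_Ioc (hq : 0 < q) (ha : 0 < a) {c : ℝ} (hc : 0 < c) :
    HasSum (fun j : ℕ => (-1) ^ j / (j.factorial * (a + q * j)) * c ^ (a + q * j))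
      (∫ s in Ioc 0 c, Real.exp (-s ^ q) * s ^ (a - 1)) := by
  have hpos (j : ℕ) : 0 < a + q * j := by positivity
  have hint (j : ℕ) : IntegrableOn (fun s : ℝ => s ^ (a + q * j - 1)) (Ioc 0 c) := by
    rw [← intervalIntegrable_iff_integrableOn_Ioc_of_le hc.le]
    exact intervalIntegral.intervalIntegrable_rpow' (by linarith [hpos j])
  have hval (j : ℕ) : ∫ s in Ioc 0 c, s ^ (a + q * j - 1) = c ^ (a + q * j) / (a + q * j) := by
    rw [← intervalIntegral.integral_of_le hc.le, integral_rpow (Or.inl (by linarith [hpos j])),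
      sub_add_cancel, Real.zero_rpow (hpos j).ne', sub_zero]
  have hnorm (j : ℕ) : ∫ s in Ioc 0 c, ‖(-1 : ℝ) ^ j / j.factorial * s ^ (a + q * j - 1)‖ =
      1 / j.factorial * (c ^ (a + q * j) / (a + q * j)) := by
    rw [← hval, ← integral_const_mul]
    refine setIntegral_congr_fun measurableSet_Ioc fun s hs => ?_
    have := Real.rpow_nonneg hs.1.le (a + q * j - 1)
    simp [abs_of_nonneg this]
  have hsum : Summable fun j : ℕ =>
      ∫ s in Ioc 0 c, ‖(-1 : ℝ) ^ j / j.factorial * s ^ (a + q * j - 1)‖ := by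
    simp only [hnorm]
    refine ((Real.summable_pow_div_factorial (c ^ q)).mul_left (c ^ a / a)).of_nonneg_of_le
      (fun j => by positivity) fun j => ?_
    rw [Real.rpow_add hc, Real.rpow_mul hc.le, Real.rpow_natCast]
    calc 1 / (j.factorial : ℝ) * (c ^ a * (c ^ q) ^ j / (a + q * j))
        ≤ 1 / (j.factorial : ℝ) * (c ^ a * (c ^ q) ^ j / a) := by
          gcongr
          have : 0 ≤ q * j := by positivity
          linarith
      _ = _ := by ring
  have h := hasSum_integral_of_summable_integral_norm
    (fun j => ((hint j).const_mul ((-1 : ℝ) ^ j / j.factorial))) hsum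
  have hseries : ∫ s in Ioc 0 c, ∑' j : ℕ, (-1 : ℝ) ^ j / j.factorial * s ^ (a + q * j - 1) =
      ∫ s in Ioc 0 c, Real.exp (-s ^ q) * s ^ (a - 1) := by
    refine setIntegral_congr_fun measurableSet_Ioc fun s hs => ?_
    have h1 : HasSum (fun j : ℕ => (-s ^ q) ^ j / j.factorial) (Real.exp (-s ^ q)) := by
      rw [Real.exp_eq_exp_ℝ]
      exact NormedSpace.expSeries_div_hasSum_exp (-s ^ q)
    refine HasSum.tsum_eq ((h1.mul_right (s ^ (a - 1))).congr_fun fun j => ?_)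
    rw [show a + q * j - 1 = (a - 1) + q * j by ring, Real.rpow_add hs.1, Real.rpow_mul hs.1.le,
      Real.rpow_natCast, neg_pow (s ^ q)]
    ring
  rw [hseries] at h
  refine h.congr_fun fun j => ?_
  rw [integral_const_mul, hval]
  have := (hpos j).ne'
  field_simp

theorem heatIntegral_eq_sub (hq : 0 < q) (ha : 0 < a) (ht : 0 < t) :
    Real.Gamma (a / q) / q - heatIntegral q a t =
      ∫ s in Ioc 0 (t ^ (1 / q)), Real.exp (-s ^ q) * s ^ (a - 1) := by
  have hc : 0 < t ^ (1 / q) := by positivity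
  have h1 := integral_rpow_mul_exp_neg_rpow (p := q) (q := a - 1) hq (by linarith)
  have h2 := integrableOn_exp_neg_rpow_mul_rpow_zero hq ha
  simp only [mul_comm, sub_add_cancel] at h1 h2 ⊢
  rw [div_eq_mul_one_div, mul_comm (Real.Gamma _), ← h1, sub_eq_iff_eq_add,
    ← Ioc_union_Ioi_eq_Ioi hc.le]
  rw [← Ioc_union_Ioi_eq_Ioi hc.le] at h2
  rw [setIntegral_union (Ioc_disjoint_Ioi le_rfl) measurableSet_Ioi h2.left_of_union
    h2.right_of_union, heatIntegral]
  simp only [mul_comm]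

theorem hasSum_heatIntegral (hq : 0 < q) (ha : 0 < a) (ht : 0 < t) :
    HasSum (fun j : ℕ => (-1) ^ j / (j.factorial * (a + q * j)) * t ^ (a / q + j))
      (Real.Gamma (a / q) / q - heatIntegral q a t) := by
  rw [heatIntegral_eq_sub hq ha ht]
  refine (hasSum_integral_Ioc hq ha (c := t ^ (1 / q)) (by positivity)).congr_fun fun j => ?_
  rw [← Real.rpow_mul ht.le]
  congr 2
  field_simp

theorem TwoSided.trans {f g h : ℝ → ℝ} {s : Set ℝ} (h₁ : TwoSided f g s) (h₂ : TwoSided g h s) :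
    TwoSided f h s := by
  obtain ⟨c, C, hc, hC, hf⟩ := h₁
  obtain ⟨d, D, hd, hD, hg⟩ := h₂
  refine ⟨c * d, C * D, mul_pos hc hd, mul_pos hC hD, fun t ht => ?_⟩
  obtain ⟨h1, h2⟩ := hf t ht
  obtain ⟨h3, h4⟩ := hg t ht
  rw [mul_assoc, mul_assoc]
  exact ⟨(mul_le_mul_of_nonneg_left h3 hc.le).trans h1,
    h2.trans (mul_le_mul_of_nonneg_left h4 hC.le)⟩

theorem TwoSided.mul_left {f g h : ℝ → ℝ} {s : Set ℝ} (hfg : TwoSided f g s)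
    (hh : ∀ t ∈ s, 0 ≤ h t) : TwoSided (fun t => h t * f t) (fun t => h t * g t) s := by
  obtain ⟨c, C, hc, hC, hf⟩ := hfg
  refine ⟨c, C, hc, hC, fun t ht => ?_⟩
  obtain ⟨h1, h2⟩ := hf t ht
  rw [mul_left_comm, mul_left_comm C]
  exact ⟨mul_le_mul_of_nonneg_left h1 (hh t ht), mul_le_mul_of_nonneg_left h2 (hh t ht)⟩

/-- For integral exponents the powers `t^{a/q + j}` are among the `t^{k/q}`, namely for
`k = r + p j`, and the Gamma expansion rearranges to a series in `t^{1/q}`. -/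
theorem exists_hasSum_heatIntegral {p r : ℕ} (hp : 0 < p) (hr : 0 < r) :
    ∃ b : ℕ → ℝ, b 0 = Real.Gamma ((r : ℝ) / p) / p ∧ ∀ t : ℝ, 0 < t →
      HasSum (fun k : ℕ => b k * t ^ ((k : ℝ) / p)) (heatIntegral p r t) := by
  have hinj : Function.Injective fun j : ℕ => r + p * j := fun i j h => by
    simpa [hp.ne'] using h
  set f : ℕ → ℝ := fun j => (-1) ^ j / (j.factorial * ((r : ℝ) + p * j)) with hf
  refine ⟨fun k => (if k = 0 then Real.Gamma ((r : ℝ) / p) / p else 0) -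
    Function.extend (fun j : ℕ => r + p * j) f 0 k, ?_, fun t ht => ?_⟩
  · have h0 : ¬∃ j : ℕ, r + p * j = 0 := by
      rintro ⟨j, hj⟩
      omega
    simp [Function.extend_apply' f (0 : ℕ → ℝ) 0 h0]
  have h1 : HasSum (fun k : ℕ => (if k = 0 then Real.Gamma ((r : ℝ) / p) / p else 0) *
      t ^ ((k : ℝ) / p)) (Real.Gamma ((r : ℝ) / p) / p) := by
    convert! hasSum_single (f := fun k : ℕ => (if k = 0 then Real.Gamma ((r : ℝ) / p) / p else 0) *
      t ^ ((k : ℝ) / p)) 0 (fun k hk => by simp [hk]) using 1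
    simp
  have h2 : HasSum (fun k : ℕ => Function.extend (fun j : ℕ => r + p * j) f 0 k *
      t ^ ((k : ℝ) / p)) (Real.Gamma ((r : ℝ) / p) / p - heatIntegral p r t) := by
    refine (hinj.hasSum_iff fun k hk => ?_).1 ?_
    · simp [Function.extend_apply' f (0 : ℕ → ℝ) k (by simpa using hk)]
    · refine (hasSum_heatIntegral (q := p) (a := r) (by positivity) (by positivity) ht).congr_fun
        fun j => ?_
      simp only [Function.comp_apply, hinj.extend_apply, hf]
      congr 2
      push_cast
      field_simp
  simpa [sub_mul] using h1.sub h2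

theorem twoSided_heatIntegral_const (hq : 0 < q) (ha : 0 < a) (hT : 0 < T) :
    TwoSided (heatIntegral q a) (fun _ => Real.Gamma (a / q) / q) (Ioc 0 T) := by
  have hb : 0 < Real.Gamma (a / q) / q := div_pos (Real.Gamma_pos_of_pos (by positivity)) hq
  refine ⟨heatIntegral q a T / (Real.Gamma (a / q) / q), 1,
    div_pos (heatIntegral_pos hq a hT) hb, one_pos, fun t ht => ?_⟩
  rw [div_mul_cancel₀ _ hb.ne', one_mul]
  refine ⟨heatIntegral_anti hq a ht.1 ht.2, ?_⟩
  rw [← sub_nonneg, heatIntegral_eq_sub hq ha ht.1]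
  refine setIntegral_nonneg measurableSet_Ioc fun s hs => ?_
  have : 0 < s := hs.1
  positivity

/-- Coefficients of a series in `t^{1/q}` comparable with the incomplete Gamma integral. Unless both
exponents are integers, the integral has no expansion in powers of `t^{1/q}`; it then suffices to
take its limit `Γ(a/q)/q` at `0` as the only term, since the integral stays between two positive
constants on bounded intervals. -/
theorem exists_coefficients (hq : 0 < q) (ha : 0 < a) :
    ∃ b : ℕ → ℝ, b 0 = Real.Gamma (a / q) / q ∧
      (∀ t, 0 < t → Summable fun k : ℕ => b k * t ^ ((k : ℝ) / q)) ∧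
      (∀ p r : ℕ, q = p → a = r → ∀ t, 0 < t →
        HasSum (fun k : ℕ => b k * t ^ ((k : ℝ) / q)) (heatIntegral q a t)) ∧
      ∀ T, 0 < T → TwoSided (heatIntegral q a)
        (fun t => ∑' k : ℕ, b k * t ^ ((k : ℝ) / q)) (Ioc 0 T) := by
  by_cases h : ∃ p r : ℕ, q = p ∧ a = r
  · obtain ⟨p, r, rfl, rfl⟩ := h
    obtain ⟨b, hb0, hb⟩ := exists_hasSum_heatIntegral (p := p) (r := r) (by exact_mod_cast hq)
      (by exact_mod_cast ha)
    refine ⟨b, hb0, fun t ht => (hb t ht).summable, fun _ _ _ _ => hb, fun T _ => ?_⟩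
    refine ⟨1, 1, one_pos, one_pos, fun t ht => ?_⟩
    simp only [(hb t ht.1).tsum_eq, one_mul, le_refl, and_self]
  · have h1 (t : ℝ) : HasSum (fun k : ℕ => (if k = 0 then Real.Gamma (a / q) / q else 0) *
        t ^ ((k : ℝ) / q)) (Real.Gamma (a / q) / q) := by
      convert! hasSum_single (f := fun k : ℕ => (if k = 0 then Real.Gamma (a / q) / q else 0) *
        t ^ ((k : ℝ) / q)) 0 (fun k hk => by simp [hk]) using 1
      simp
    refine ⟨fun k => if k = 0 then Real.Gamma (a / q) / q else 0, by simp,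
      fun t _ => (h1 t).summable, fun p r hp hr => absurd ⟨p, r, hp, hr⟩ h, fun T hT => ?_⟩
    simp only [(h1 _).tsum_eq]
    exact twoSided_heatIntegral_const hq ha hT

end HeatIntegral

/-! ### Spectral sums under the Weyl law -/

section Spectral

open scoped ENNReal NNReal

variable {ι : Type*} {w g : ι → ℝ} {Q q m T : ℝ}

/-- Under the Weyl law the blocks of any sufficiently large ratio `B` contain about `B^{kQ}` points:
the lower bound at `B^k` has to beat the upper bound at `B^{k-1}`. -/
theorem exists_block_counting (hfin : ∀ r, {ξ | w ξ ≤ r}.Finite)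
    (hw : (fun r : ℝ => ({ξ | w ξ ≤ r}.ncard : ℝ)) =Θ[atTop] fun r => r ^ Q) (hQ : 0 < Q) :
    ∃ B : ℝ, 1 < B ∧ ∃ (C c : ℝ) (K : ℕ), 0 < C ∧ 0 < c ∧
      (∀ k : ℕ, ({ξ | w ξ ≤ B ^ k}.ncard : ℝ) ≤ C * (B ^ k) ^ Q) ∧
      ∀ k : ℕ, K ≤ k → c * (B ^ k) ^ Q ≤ ({ξ | w ξ ∈ Ioc (B ^ k / B) (B ^ k)}.ncard : ℝ) := by
  obtain ⟨C, hC, hC'⟩ := hw.1.exists_pos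
  obtain ⟨D, hD, hD'⟩ := hw.2.exists_pos
  obtain ⟨R, hR⟩ := eventually_atTop.1
    ((hC'.bound.and hD'.bound).and (eventually_ge_atTop (1 : ℝ)))
  have hR1 : 1 ≤ R := (hR R le_rfl).2
  have hup (r : ℝ) (hr : R ≤ r) : ({ξ | w ξ ≤ r}.ncard : ℝ) ≤ C * r ^ Q := by
    have := (hR r hr).1.1
    rwa [Real.norm_of_nonneg (by positivity), Real.norm_of_nonneg
      (Real.rpow_nonneg (by linarith) Q)] at this
  have hlo (r : ℝ) (hr : R ≤ r) : r ^ Q ≤ D * ({ξ | w ξ ≤ r}.ncard : ℝ) := by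
    have := (hR r hr).1.2
    rwa [Real.norm_of_nonneg (Real.rpow_nonneg (by linarith) Q),
      Real.norm_of_nonneg (by positivity)] at this
  obtain ⟨B, hB, hBQ⟩ : ∃ B : ℝ, 1 < B ∧ 2 * C * D ≤ B ^ Q :=
    ((eventually_gt_atTop 1).and ((tendsto_rpow_atTop hQ).eventually_ge_atTop (2 * C * D))).exists
  have hB0 : 0 < B := by linarith
  obtain ⟨K, hK⟩ := pow_unbounded_of_one_lt (R * B) hB
  refine ⟨B, hB, C * R ^ Q, 1 / (2 * D), K, by positivity, by positivity, fun k => ?_,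
    fun k hk => ?_⟩
  · have hk1 : 1 ≤ B ^ k := one_le_pow₀ hB.le
    have h1 : B ^ k ≤ R * B ^ k := le_mul_of_one_le_left (by positivity) hR1
    have h2 : R ≤ R * B ^ k := le_mul_of_one_le_right (by positivity) hk1
    have h3 : {ξ | w ξ ≤ B ^ k}.ncard ≤ {ξ | w ξ ≤ R * B ^ k}.ncard :=
      ncard_le_ncard (fun ξ (hξ : w ξ ≤ _) => hξ.trans h1) (hfin _)
    have h4 := hup _ h2
    rw [Real.mul_rpow (by positivity) (by positivity), ← mul_assoc] at h4
    exact (Nat.cast_le.2 h3).trans h4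
  · have hRk : R * B ≤ B ^ k := hK.le.trans (pow_le_pow_right₀ hB.le hk)
    have hRk' : R ≤ B ^ k / B := (le_div_iff₀ hB0).2 hRk
    have hle : B ^ k / B ≤ B ^ k := div_le_self (by positivity) hB.le
    have heq : {ξ | w ξ ∈ Ioc (B ^ k / B) (B ^ k)} = {ξ | w ξ ≤ B ^ k} \ {ξ | w ξ ≤ B ^ k / B} := by
      ext ξ
      simp [and_comm]
    have h1 := ncard_sdiff_add_ncard_of_subset (s := {ξ | w ξ ≤ B ^ k / B}) (t := {ξ | w ξ ≤ B ^ k})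
      (fun ξ (hξ : w ξ ≤ _) => hξ.trans hle) (hfin _)
    rw [← heq] at h1
    have h1' : ({ξ | w ξ ∈ Ioc (B ^ k / B) (B ^ k)}.ncard : ℝ) +
        ({ξ | w ξ ≤ B ^ k / B}.ncard : ℝ) =
      {ξ | w ξ ≤ B ^ k}.ncard := by exact_mod_cast h1
    have h2 := hup _ hRk'
    have h3 := hlo _ (hRk'.trans hle)
    set X : ℝ := (B ^ k) ^ Q with hX
    have hX0 : 0 < X := by positivity
    have h4 : C * (B ^ k / B) ^ Q ≤ X / (2 * D) := by
      rw [Real.div_rpow (by positivity) hB0.le, ← hX, mul_div_assoc', div_le_div_iff₀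
        (by positivity) (by positivity)]
      nlinarith
    have h5 : X / D ≤ {ξ | w ξ ≤ B ^ k}.ncard := by
      rw [div_le_iff₀ hD]
      linarith
    have h6 : X / D = X / (2 * D) + X / (2 * D) := by field_simp; norm_num
    rw [one_div_mul_eq_div]
    linarith

/-- The measure `∑ g_ξ δ_{w_ξ}`. -/
noncomputable def spectralMeasure (w g : ι → ℝ) : Measure ℝ :=
  Measure.sum fun ξ => ENNReal.ofReal (g ξ) • Measure.dirac (w ξ)

theorem lintegral_spectralMeasure (f : ℝ → ℝ≥0∞) :
    ∫⁻ r, f r ∂(spectralMeasure w g) = ∑' ξ, ENNReal.ofReal (g ξ) * f (w ξ) := by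
  simp [spectralMeasure, lintegral_sum_measure, lintegral_smul_measure]

theorem spectralMeasure_apply (s : Set ℝ) (hs : MeasurableSet s) :
    spectralMeasure w g s = ∑' ξ : {ξ | w ξ ∈ s}, ENNReal.ofReal (g ξ) := by
  rw [spectralMeasure, Measure.sum_apply _ hs, tsum_subtype {ξ | w ξ ∈ s}
    fun ξ => ENNReal.ofReal (g ξ)]
  refine tsum_congr fun ξ => ?_
  by_cases h : w ξ ∈ s <;> simp [h, hs, indicator]

theorem spectralMeasure_Iio_one (hw1 : ∀ ξ, 1 ≤ w ξ) : spectralMeasure w g (Iio 1) = 0 := by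
  rw [spectralMeasure_apply _ measurableSet_Iio, ENNReal.tsum_eq_zero]
  exact fun ξ => absurd ξ.2 (not_lt.2 (hw1 ξ))

theorem ofReal_ncard_eq_encard {s : Set ι} (hs : s.Finite) :
    (s.encard : ℝ≥0∞) = ENNReal.ofReal s.ncard := by
  rw [← hs.cast_ncard_eq]
  simp

theorem spectralMeasure_block_le {B C C₁ : ℝ} (hB : 1 < B) (hfin : ∀ r, {ξ | w ξ ≤ r}.Finite)
    (hC : 0 < C) (hN : ∀ k : ℕ, ({ξ | w ξ ≤ B ^ k}.ncard : ℝ) ≤ C * (B ^ k) ^ Q)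
    (hC₁ : 0 ≤ C₁) (hg : ∀ ξ, g ξ ≤ C₁ * w ξ ^ m) (k : ℕ) :
    spectralMeasure w g (Ioc (B ^ k / B) (B ^ k)) ≤
      (C₁ * B ^ |m| * C).toNNReal * ENNReal.ofReal ((B ^ k) ^ (Q + m)) := by
  have hB0 : 0 < B := by linarith
  have hk : 0 < B ^ k := by positivity
  have hsub : {ξ | w ξ ∈ Ioc (B ^ k / B) (B ^ k)} ⊆ {ξ | w ξ ≤ B ^ k} := fun ξ hξ => hξ.2
  rw [spectralMeasure_apply _ measurableSet_Ioc]
  calc _ ≤ ∑' ξ : {ξ | w ξ ∈ Ioc (B ^ k / B) (B ^ k)},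
        ENNReal.ofReal (C₁ * (B ^ |m| * (B ^ k) ^ m)) := by
        refine ENNReal.tsum_le_tsum fun ξ => ENNReal.ofReal_le_ofReal ((hg ξ).trans ?_)
        gcongr
        exact (rpow_le_of_mem_block hB ξ.2 hk).1
    _ = ENNReal.ofReal {ξ | w ξ ∈ Ioc (B ^ k / B) (B ^ k)}.ncard *
        ENNReal.ofReal (C₁ * (B ^ |m| * (B ^ k) ^ m)) := by
        rw [ENNReal.tsum_set_const, ofReal_ncard_eq_encard ((hfin _).subset hsub)]
    _ ≤ ENNReal.ofReal (C * (B ^ k) ^ Q) * ENNReal.ofReal (C₁ * (B ^ |m| * (B ^ k) ^ m)) := by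
        gcongr
        exact (Nat.cast_le.2 (ncard_le_ncard hsub (hfin _))).trans (hN k)
    _ = _ := by
        change _ = ENNReal.ofReal _ * _
        rw [← ENNReal.ofReal_mul (by positivity), ← ENNReal.ofReal_mul (by positivity),
          Real.rpow_add hk]
        ring_nf

theorem le_spectralMeasure_block {B c c₁ N₀ : ℝ} {K : ℕ} (hB : 1 < B)
    (hfin : ∀ r, {ξ | w ξ ≤ r}.Finite) (hc : 0 < c)
    (hN : ∀ k : ℕ, K ≤ k → c * (B ^ k) ^ Q ≤ ({ξ | w ξ ∈ Ioc (B ^ k / B) (B ^ k)}.ncard : ℝ))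
    (hc₁ : 0 < c₁) (hg : ∀ ξ, N₀ ≤ w ξ → c₁ * w ξ ^ m ≤ g ξ) :
    ∃ K' : ℕ, ∀ k, K' ≤ k → ENNReal.ofReal ((B ^ k) ^ (Q + m)) ≤
      (B ^ |m| / (c * c₁)).toNNReal * spectralMeasure w g (Ioc (B ^ k / B) (B ^ k)) := by
  have hB0 : 0 < B := by linarith
  obtain ⟨K₁, hK₁⟩ := pow_unbounded_of_one_lt (N₀ * B) hB
  refine ⟨max K K₁, fun k hkK => ?_⟩
  have hk : 0 < B ^ k := by positivity
  have hsub : {ξ | w ξ ∈ Ioc (B ^ k / B) (B ^ k)} ⊆ {ξ | w ξ ≤ B ^ k} := fun ξ hξ => hξ.2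
  have hN₀ : N₀ ≤ B ^ k / B := (le_div_iff₀ hB0).2
    (hK₁.le.trans (pow_le_pow_right₀ hB.le ((le_max_right _ _).trans hkK)))
  rw [spectralMeasure_apply _ measurableSet_Ioc]
  calc ENNReal.ofReal ((B ^ k) ^ (Q + m))
      = ENNReal.ofReal (B ^ |m| / (c * c₁)) * (ENNReal.ofReal (c * (B ^ k) ^ Q) *
          ENNReal.ofReal (c₁ * ((B ^ k) ^ m / B ^ |m|))) := by
        rw [← ENNReal.ofReal_mul (by positivity), ← ENNReal.ofReal_mul (by positivity),
          Real.rpow_add hk]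
        congr 1
        have : 0 < B ^ |m| := by positivity
        field_simp
    _ ≤ ENNReal.ofReal (B ^ |m| / (c * c₁)) *
          (ENNReal.ofReal {ξ | w ξ ∈ Ioc (B ^ k / B) (B ^ k)}.ncard *
          ENNReal.ofReal (c₁ * ((B ^ k) ^ m / B ^ |m|))) := by
        gcongr
        exact hN k ((le_max_left _ _).trans hkK)
    _ = ENNReal.ofReal (B ^ |m| / (c * c₁)) *
          ∑' ξ : {ξ | w ξ ∈ Ioc (B ^ k / B) (B ^ k)},
            ENNReal.ofReal (c₁ * ((B ^ k) ^ m / B ^ |m|)) := by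
        rw [ENNReal.tsum_set_const, ofReal_ncard_eq_encard ((hfin _).subset hsub)]
    _ ≤ _ := by
        refine mul_le_mul_right (ENNReal.tsum_le_tsum fun ξ => ENNReal.ofReal_le_ofReal ?_) _
        refine le_trans ?_ (hg ξ (hN₀.trans ξ.2.1.le))
        gcongr
        rw [div_le_iff₀ (by positivity), mul_comm]
        exact (rpow_le_of_mem_block hB ξ.2 hk).2

theorem lintegral_powerMeasure_eq_ofReal {a t : ℝ} (hq : 0 < q) (ht : 0 < t) :
    ∫⁻ r, ENNReal.ofReal (Real.exp (-t * r ^ q)) ∂(powerMeasure a) =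
      ENNReal.ofReal (t ^ (-(a / q)) * heatIntegral q a t) := by
  rw [lintegral_powerMeasure, ← integral_Ioi_one_eq hq a ht,
    ofReal_integral_eq_lintegral_ofReal (integrableOn_exp_neg_mul_rpow_mul_rpow hq a ht)]
  refine (ae_restrict_iff' measurableSet_Ioi).2 (Eventually.of_forall fun r hr => ?_)
  have : (0 : ℝ) < r := zero_lt_one.trans hr
  simp only [Pi.zero_apply]
  positivity

/-- If `g_ξ` is of order at most `m`, then `∑ g_ξ exp(-t w_ξ^q)` converges and is at most a multiple
of `∫_1^∞ exp(-t r^q) r^{Q+m-1} dr = t^{-(Q+m)/q} ∫_{t^{1/q}}^∞ exp(-s^q) s^{Q+m-1} ds`. -/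
theorem exists_tsum_le (hw1 : ∀ ξ, 1 ≤ w ξ) (hfin : ∀ r, {ξ | w ξ ≤ r}.Finite)
    (hw : (fun r : ℝ => ({ξ | w ξ ≤ r}.ncard : ℝ)) =Θ[atTop] fun r => r ^ Q) (hQ : 0 < Q)
    (hq : 0 < q) (hg0 : ∀ ξ, 0 ≤ g ξ) {C : ℝ} (hC : 0 ≤ C) (hg : ∀ ξ, g ξ ≤ C * w ξ ^ m) (T : ℝ) :
    ∃ c : ℝ, 0 ≤ c ∧ ∀ t ∈ Ioc 0 T, (Summable fun ξ => g ξ * Real.exp (-t * w ξ ^ q)) ∧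
      ∑' ξ, g ξ * Real.exp (-t * w ξ ^ q) ≤
        c * (t ^ (-((Q + m) / q)) * heatIntegral q (Q + m) t) := by
  obtain ⟨B, hB, C₁, _, _, hC₁, _, hN, _⟩ := exists_block_counting hfin hw hQ
  obtain ⟨C₂, hC₂⟩ := le_powerMeasure_block (a := Q + m) hB
  obtain ⟨c, hc⟩ := lintegral_le_mul_lintegral (T := T) hB hq (spectralMeasure_Iio_one hw1)
    (spectralMeasure_block_le hB hfin hC₁ hN hC hg) hC₂
  refine ⟨c, c.coe_nonneg, fun t ht => ?_⟩
  have h1 := hc t ht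
  have h0 (ξ : ι) : 0 ≤ g ξ * Real.exp (-t * w ξ ^ q) := mul_nonneg (hg0 ξ) (Real.exp_pos _).le
  rw [lintegral_powerMeasure_eq_ofReal hq ht.1, lintegral_spectralMeasure] at h1
  simp only [← ENNReal.ofReal_mul (hg0 _)] at h1
  have hs : Summable fun ξ => g ξ * Real.exp (-t * w ξ ^ q) := by
    refine (ENNReal.summable_toReal (h1.trans_lt
      (ENNReal.mul_lt_top ENNReal.coe_lt_top ENNReal.ofReal_lt_top)).ne).congr fun ξ => ?_
    rw [ENNReal.toReal_ofReal (h0 ξ)]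
  refine ⟨hs, ?_⟩
  rw [← ENNReal.ofReal_tsum_of_nonneg h0 hs, ← ENNReal.ofReal_coe_nnreal,
    ← ENNReal.ofReal_mul c.coe_nonneg] at h1
  refine (ENNReal.ofReal_le_ofReal_iff (mul_nonneg c.coe_nonneg ?_)).1 h1
  exact mul_nonneg (Real.rpow_nonneg ht.1.le _) (heatIntegral_pos hq _ ht.1).le

/-- If `g_ξ` is of order at least `m`, then `∑ g_ξ exp(-t w_ξ^q)`, where it converges, is at least a
multiple of `t^{-(Q+m)/q} ∫_{t^{1/q}}^∞ exp(-s^q) s^{Q+m-1} ds`. -/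
theorem exists_le_tsum (hfin : ∀ r, {ξ | w ξ ≤ r}.Finite)
    (hw : (fun r : ℝ => ({ξ | w ξ ≤ r}.ncard : ℝ)) =Θ[atTop] fun r => r ^ Q) (hQ : 0 < Q)
    (hq : 0 < q) (hg0 : ∀ ξ, 0 ≤ g ξ) {c₁ N₀ : ℝ} (hc₁ : 0 < c₁)
    (hg : ∀ ξ, N₀ ≤ w ξ → c₁ * w ξ ^ m ≤ g ξ) (T : ℝ) :
    ∃ c : ℝ, 0 ≤ c ∧ ∀ t ∈ Ioc 0 T, (Summable fun ξ => g ξ * Real.exp (-t * w ξ ^ q)) →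
      t ^ (-((Q + m) / q)) * heatIntegral q (Q + m) t ≤
        c * ∑' ξ, g ξ * Real.exp (-t * w ξ ^ q) := by
  obtain ⟨B, hB, _, c₀, K, _, hc₀, _, hN⟩ := exists_block_counting hfin hw hQ
  obtain ⟨C₂, hC₂⟩ := powerMeasure_block_le (a := Q + m) hB
  obtain ⟨K', hK'⟩ := le_spectralMeasure_block hB hfin hc₀ hN hc₁ hg
  obtain ⟨c, hc⟩ := lintegral_le_mul_lintegral (T := T) hB hq (powerMeasure_Iio_one (Q + m))
    hC₂ hK'
  refine ⟨c, c.coe_nonneg, fun t ht hs => ?_⟩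
  have h1 := hc t ht
  have h0 (ξ : ι) : 0 ≤ g ξ * Real.exp (-t * w ξ ^ q) := mul_nonneg (hg0 ξ) (Real.exp_pos _).le
  rw [lintegral_powerMeasure_eq_ofReal hq ht.1, lintegral_spectralMeasure] at h1
  simp only [← ENNReal.ofReal_mul (hg0 _)] at h1
  rw [← ENNReal.ofReal_tsum_of_nonneg h0 hs, ← ENNReal.ofReal_coe_nnreal,
    ← ENNReal.ofReal_mul c.coe_nonneg] at h1
  exact (ENNReal.ofReal_le_ofReal_iff (mul_nonneg c.coe_nonneg (tsum_nonneg h0))).1 h1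

/-- Heat traces of positive coefficients of exact order `m`. -/
theorem twoSided_tsum (hw1 : ∀ ξ, 1 ≤ w ξ) (hfin : ∀ r, {ξ | w ξ ≤ r}.Finite)
    (hw : (fun r : ℝ => ({ξ | w ξ ≤ r}.ncard : ℝ)) =Θ[atTop] fun r => r ^ Q) (hQ : 0 < Q)
    (hq : 0 < q) (hg0 : ∀ ξ, 0 ≤ g ξ) {C : ℝ} (hC : 0 ≤ C) (hg : ∀ ξ, g ξ ≤ C * w ξ ^ m)
    {c₁ N₀ : ℝ} (hc₁ : 0 < c₁) (hg' : ∀ ξ, N₀ ≤ w ξ → c₁ * w ξ ^ m ≤ g ξ) (T : ℝ) :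
    TwoSided (fun t => ∑' ξ, g ξ * Real.exp (-t * w ξ ^ q))
      (fun t => t ^ (-((Q + m) / q)) * heatIntegral q (Q + m) t) (Ioc 0 T) := by
  obtain ⟨c, hc0, hc⟩ := exists_tsum_le hw1 hfin hw hQ hq hg0 hC hg T
  obtain ⟨d, hd0, hd⟩ := exists_le_tsum hfin hw hQ hq hg0 hc₁ hg' T
  refine ⟨1 / (d + 1), c + 1, by positivity, by positivity, fun t ht => ?_⟩
  obtain ⟨hs, h1⟩ := hc t ht
  have h2 := hd t ht hs
  have h3 : 0 ≤ ∑' ξ, g ξ * Real.exp (-t * w ξ ^ q) :=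
    tsum_nonneg fun ξ => mul_nonneg (hg0 ξ) (Real.exp_pos _).le
  have h4 : 0 < t ^ (-((Q + m) / q)) * heatIntegral q (Q + m) t :=
    mul_pos (Real.rpow_pos_of_pos ht.1 _) (heatIntegral_pos hq _ ht.1)
  refine ⟨?_, by linarith⟩
  rw [one_div_mul_eq_div, div_le_iff₀ (by positivity)]
  linarith

end Spectral

/-! ### The composition of an operator with the heat semigroup -/

section HeatTrace

variable {M : Type*} [MeasurableSpace M] {μ : Measure M}
  {L : Lp ℂ 2 μ →ₗ.[ℂ] Lp ℂ 2 μ} {ι : Type*} {ν Q q m t : ℝ}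

theorem EigenSystem.one_le_weight (S : EigenSystem μ L ι) (hν : 0 < ν) (ξ : ι) :
    1 ≤ S.weight ν ξ :=
  Real.one_le_rpow (by linarith [sq_nonneg ‖S.ev ξ‖]) (by positivity)

theorem EigenSystem.weight_rpow (S : EigenSystem μ L ι) (ξ : ι) (q : ℝ) :
    S.weight ν ξ ^ q = (1 + ‖S.ev ξ‖ ^ 2) ^ (q / (2 * ν)) := by
  rw [EigenSystem.weight, ← Real.rpow_mul (by positivity), one_div_mul_eq_div]

theorem EigenSystem.norm_ev_le (S : EigenSystem μ L ι) (hν : 0 < ν) (ξ : ι) :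
    ‖S.ev ξ‖ ≤ S.weight ν ξ ^ ν := by
  rw [S.weight_rpow, show ν / (2 * ν) = 1 / 2 by field_simp, ← Real.sqrt_eq_rpow]
  exact Real.le_sqrt_of_sq_le (by linarith)

theorem EigenSystem.WeylLaw.countable {S : EigenSystem μ L ι} (h : S.WeylLaw ν Q) :
    Countable ι := by
  rw [← countable_univ_iff]
  refine (countable_iUnion fun n : ℕ => (h.1 n).countable).mono fun ξ _ => ?_
  exact mem_iUnion.2 (exists_nat_ge (S.weight ν ξ))

theorem EigenSystem.WeylLaw.summable {S : EigenSystem μ L ι} (h : S.WeylLaw ν Q) (hν : 0 < ν)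
    (hQ : 0 < Q) (hq : 0 < q) (ht : 0 < t) (m : ℝ) :
    Summable fun ξ => S.weight ν ξ ^ m * Real.exp (-t * S.weight ν ξ ^ q) := by
  obtain ⟨c, -, hc⟩ := exists_tsum_le (g := fun ξ => S.weight ν ξ ^ m) (m := m)
    (S.one_le_weight hν) h.1 h.2 hQ hq
    (fun ξ => Real.rpow_nonneg (zero_le_one.trans (S.one_le_weight hν ξ)) m) zero_le_one
    (fun ξ => (one_mul _).ge) t
  exact (hc t ⟨ht, le_rfl⟩).1

/-- The coefficients of `exp(-t M_q) f` decay rapidly with respect to the eigenvalues. -/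
theorem EigenSystem.WeylLaw.summable_heat {S : EigenSystem μ L ι} (h : S.WeylLaw ν Q) (hν : 0 < ν)
    (hQ : 0 < Q) (hq : 0 < q) (ht : 0 < t) (f : Lp ℂ 2 μ) (j : ℕ) :
    Summable fun ξ => ‖S.ev ξ ^ j *
      ((Real.exp (-t * S.weight ν ξ ^ q) : ℂ) * S.basis.repr f ξ)‖ := by
  refine ((h.summable hν hQ hq ht (ν * j)).mul_left ‖f‖).of_nonneg_of_le
    (fun ξ => norm_nonneg _) fun ξ => ?_
  have hw := S.one_le_weight hν ξ
  have h1 : ‖S.basis.repr f ξ‖ ≤ ‖f‖ :=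
    (lp.norm_apply_le_norm two_ne_zero _ ξ).trans_eq (S.basis.repr.norm_map f)
  have h2 : ‖S.ev ξ‖ ^ j ≤ S.weight ν ξ ^ (ν * j) := by
    rw [Real.rpow_mul (zero_le_one.trans hw), Real.rpow_natCast]
    exact pow_le_pow_left₀ (norm_nonneg _) (S.norm_ev_le hν ξ) j
  rw [norm_mul, norm_pow, norm_mul, Complex.norm_real, Real.norm_of_nonneg (Real.exp_pos _).le]
  calc ‖S.ev ξ‖ ^ j * (Real.exp (-t * S.weight ν ξ ^ q) * ‖S.basis.repr f ξ‖)
      ≤ S.weight ν ξ ^ (ν * j) * (Real.exp (-t * S.weight ν ξ ^ q) * ‖f‖) := by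
        have := Real.rpow_nonneg (zero_le_one.trans hw) (ν * j)
        gcongr
    _ = _ := by ring

/-- The heat operator is defined on all of `L²`, where it is given by its eigenfunction
expansion. -/
theorem EigenSystem.WeylLaw.heat_hasSum {S : EigenSystem μ L ι} (h : S.WeylLaw ν Q) (hν : 0 < ν)
    (hQ : 0 < Q) (hq : 0 < q) (ht : 0 < t) (f : Lp ℂ 2 μ) :
    ∃ hf : f ∈ (S.heat ν q t).domain,
      HasSum (fun ξ => ((Real.exp (-t * S.weight ν ξ ^ q) : ℂ) * S.basis.repr f ξ) • S.basis ξ)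
        (S.heat ν q t ⟨f, hf⟩) := by
  have hs := h.summable_heat hν hQ hq ht f 0
  simp only [pow_zero, one_mul] at hs
  have hmem : Memℓp (fun ξ => (Real.exp (-t * S.weight ν ξ ^ q) : ℂ) * S.basis.repr f ξ) 2 := by
    have h1 : Memℓp (fun ξ => (Real.exp (-t * S.weight ν ξ ^ q) : ℂ) * S.basis.repr f ξ) 1 :=
      memℓp_gen (by simpa using hs)
    exact h1.of_exponent_ge one_le_two
  have heq : S.heat ν q t = diagonalOperator S.basis fun ξ =>
      (Real.exp (-t * S.weight ν ξ ^ q) : ℂ) := by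
    simp only [EigenSystem.heat, S.weight_rpow]
  rw [heq]
  exact ⟨hmem, S.basis.hasSum_repr_symm ⟨_, hmem⟩⟩

/-- The bilinear pairing with a fixed `L²` function is an inner product. -/
theorem exists_inner_eq_integral_mul (φ : Lp ℂ 2 μ) :
    ∃ ψ : Lp ℂ 2 μ, ∀ h : Lp ℂ 2 μ, inner ℂ ψ h = ∫ x, h x * φ x ∂μ := by
  refine ⟨star φ, fun h => ?_⟩
  rw [L2.inner_def]
  refine integral_congr_ae ?_
  filter_upwards [Lp.coeFn_star φ] with x hx
  rw [hx, RCLike.inner_apply]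
  simp

variable {σ : M → ι → ℂ} {C : ℝ}

theorem EigenSystem.memLp_u (S : EigenSystem μ L ι) (ξ : ι) : MemLp (S.u ξ) 2 μ :=
  (Lp.memLp (S.basis ξ)).ae_eq (S.basis_ae_eq ξ)

theorem EigenSystem.integrable_norm_sq (S : EigenSystem μ L ι) (ξ : ι) :
    Integrable (fun x => ‖S.u ξ x‖ ^ 2) μ :=
  (memLp_two_iff_integrable_sq_norm (S.memLp_u ξ).1).1 (S.memLp_u ξ)

theorem EigenSystem.integral_norm_sq (S : EigenSystem μ L ι) (ξ : ι) :
    ∫ x, ‖S.u ξ x‖ ^ 2 ∂μ = 1 := by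
  have h1 : inner ℂ (S.basis ξ) (S.basis ξ) = (1 : ℂ) := by
    rw [inner_self_eq_norm_sq_to_K, S.basis.orthonormal.1]
    simp
  rw [L2.inner_def] at h1
  have h2 : ∫ x, ((‖S.u ξ x‖ ^ 2 : ℝ) : ℂ) ∂μ = 1 := by
    rw [← h1]
    refine integral_congr_ae ?_
    filter_upwards [S.basis_ae_eq ξ] with x hx
    rw [hx, inner_self_eq_norm_sq_to_K]
    simp
  rw [integral_complex_ofReal] at h2
  exact_mod_cast h2

theorem EigenSystem.memLp_mul_u (S : EigenSystem μ L ι) {a : M → ℂ}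
    (ha : AEStronglyMeasurable a μ) (hC : ∀ x, ‖a x‖ ≤ C) (ξ : ι) :
    MemLp (fun x => a x * S.u ξ x) 2 μ :=
  (S.memLp_u ξ).of_le_mul (c := C) (ha.mul (S.memLp_u ξ).1) (Eventually.of_forall fun x => by
    rw [norm_mul]
    gcongr
    exact hC x)

theorem EigenSystem.norm_toLp_mul_u_le (S : EigenSystem μ L ι) {a : M → ℂ}
    (hC : ∀ x, ‖a x‖ ≤ C) (ξ : ι) (h : MemLp (fun x => a x * S.u ξ x) 2 μ) :
    ‖h.toLp‖ ≤ C := by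
  have h1 : ‖h.toLp‖ ≤ C * ‖S.basis ξ‖ := by
    refine Lp.norm_le_mul_norm_of_ae_le_mul ?_
    filter_upwards [h.coeFn_toLp, S.basis_ae_eq ξ] with x hx hx'
    rw [hx, hx', norm_mul]
    gcongr
    exact hC x
  rwa [S.basis.orthonormal.1, mul_one] at h1

/-- The diagonal matrix element `∫ a |u_ξ|²` of multiplication by a real function `a`. -/
theorem EigenSystem.inner_basis_toLp (S : EigenSystem μ L ι) {a : M → ℂ}
    (ha : ∀ x, (a x).im = 0) (ξ : ι) (h : MemLp (fun x => a x * S.u ξ x) 2 μ) :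
    inner ℂ (S.basis ξ) h.toLp = ((∫ x, (a x).re * ‖S.u ξ x‖ ^ 2 ∂μ : ℝ) : ℂ) := by
  rw [L2.inner_def, ← integral_complex_ofReal]
  refine integral_congr_ae ?_
  filter_upwards [h.coeFn_toLp, S.basis_ae_eq ξ] with x hx hx'
  rw [hx, hx', RCLike.inner_apply, mul_assoc, RCLike.mul_conj]
  have : a x = ((a x).re : ℂ) := Complex.ext rfl (ha x)
  rw [this]
  simp

/-- If `A` has a real measurable symbol of order `m`, then `A exp(-t M_q)` is given by the trace class
operator `∑_ξ exp(-t ⟨ξ⟩^q) ⟨·, u_ξ⟩ σ(·, ξ) u_ξ`, whose trace is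
`∑_ξ exp(-t ⟨ξ⟩^q) ∫ σ(x, ξ) |u_ξ(x)|² dx`. -/
theorem EigenSystem.WeylLaw.hasHeatTrace {S : EigenSystem μ L ι} (h : S.WeylLaw ν Q) (hν : 0 < ν)
    (hQ : 0 < Q) (hq : 0 < q) (ht : 0 < t) (hL : L.IsClosed)
    {A : testSpace L →ₗ[ℂ] LDistribution L} (hA : IsContinuousOperator L A)
    (hAσ : HasSymbol S A σ) (hmeas : ∀ ξ, AEStronglyMeasurable (fun x => σ x ξ) μ)
    (hC : ∀ x ξ, ‖σ x ξ‖ ≤ C * S.weight ν ξ ^ m) (him : ∀ x ξ, (σ x ξ).im = 0) :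
    HasHeatTrace S ν q A t ((∑' ξ, (∫ x, (σ x ξ).re * ‖S.u ξ x‖ ^ 2 ∂μ) *
      Real.exp (-t * S.weight ν ξ ^ q) : ℝ) : ℂ) := by
  have := h.countable
  have hmem (ξ : ι) : MemLp (fun x => σ x ξ * S.u ξ x) 2 μ :=
    S.memLp_mul_u (hmeas ξ) (hC · ξ) ξ
  set e : ι → ℂ := fun ξ => (Real.exp (-t * S.weight ν ξ ^ q) : ℂ) with he
  set v : ι → Lp ℂ 2 μ := fun ξ => (hmem ξ).toLp with hv
  have hs : Summable fun ξ => ‖e ξ • v ξ‖ * ‖S.basis ξ‖ := by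
    refine ((h.summable hν hQ hq ht m).mul_left C).of_nonneg_of_le (fun ξ => by positivity)
      fun ξ => ?_
    rw [S.basis.orthonormal.1, mul_one, norm_smul, he, Complex.norm_real,
      Real.norm_of_nonneg (Real.exp_pos _).le]
    calc _ ≤ Real.exp (-t * S.weight ν ξ ^ q) * (C * S.weight ν ξ ^ m) := by
          gcongr
          exact S.norm_toLp_mul_u_le (hC · ξ) ξ (hmem ξ)
      _ = _ := by ring
  obtain ⟨T, hT⟩ := exists_hasSum_rankOne hs
  refine ⟨T, fun f => ?_, ?_⟩
  · obtain ⟨hf, hsum⟩ := h.heat_hasSum hν hQ hq ht f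
    have hdecay := h.summable_heat hν hQ hq ht f
    have hg := S.mem_testSpace_of_hasSum hL hdecay hsum
    refine ⟨hf, hg, fun φ => ?_⟩
    have h1 := S.hasSum_apply hL hA hdecay ⟨_, hg⟩ hsum φ
    obtain ⟨ψ, hψ⟩ := exists_inner_eq_integral_mul (φ : Lp ℂ 2 μ)
    have h2 := (hT f).mapL (innerSL ℂ ψ)
    rw [← hψ]
    refine h1.unique (h2.congr_fun fun ξ => ?_)
    rw [hAσ ξ φ, innerSL_apply_apply, inner_smul_right, inner_smul_right, hψ,
      S.basis.repr_apply_apply]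
    have h3 : ∫ x, v ξ x * (φ : Lp ℂ 2 μ) x ∂μ =
        ∫ x, σ x ξ * S.u ξ x * (φ : Lp ℂ 2 μ) x ∂μ := by
      refine integral_congr_ae ?_
      filter_upwards [(hmem ξ).coeFn_toLp] with x hx
      rw [hv, hx]
    rw [h3]
    ring
  · have h4 := hasTrace_of_hasSum hs hT
    have h5 : ∑' ξ, inner ℂ (S.basis ξ) (e ξ • v ξ) =
        ((∑' ξ, (∫ x, (σ x ξ).re * ‖S.u ξ x‖ ^ 2 ∂μ) *
          Real.exp (-t * S.weight ν ξ ^ q) : ℝ) : ℂ) := by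
      rw [Complex.ofReal_tsum]
      refine tsum_congr fun ξ => ?_
      rw [inner_smul_right, hv, S.inner_basis_toLp (him · ξ) ξ (hmem ξ), Complex.ofReal_mul,
        mul_comm]
    rwa [h5] at h4

end HeatTrace

end NonHarmonic

/-! ### Asymptotics of the heat trace -/

theorem mainTheorem4 {n : ℕ} [NeZero n] {M : Type*} [TopologicalSpace M] [T2Space M]
    [SecondCountableTopology M] [ChartedSpace (EuclideanHalfSpace n) M]
    [IsManifold (𝓡∂ n) ∞ M] [MeasurableSpace M] [BorelSpace M] (μ : Measure M)
    (L : Lp ℂ 2 μ →ₗ.[ℂ] Lp ℂ 2 μ) (hL : IsSelfAdjoint L)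
    {ι : Type*} (S : NonHarmonic.EigenSystem μ L ι)
    {ν Q q m ρ δ : ℝ} (hν : 0 < ν) (hQ : 0 < Q) (hq : 0 < q)
    (hρ : ρ ∈ Icc (0 : ℝ) 1) (hδ : δ ∈ Icc (0 : ℝ) 1)
    (hWeyl : S.WeylLaw ν Q)
    (A : NonHarmonic.testSpace L →ₗ[ℂ] NonHarmonic.LDistribution L)
    (hA : NonHarmonic.IsContinuousOperator L A)
    (σ : M → ι → ℂ) (hAσ : NonHarmonic.HasSymbol S A σ)
    (hσ : NonHarmonic.SymbolClass n S ν m ρ δ σ)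
    (hpos : NonHarmonic.IsPositiveSymbol σ)
    (hell : NonHarmonic.IsLElliptic S ν m σ) :
    ∃ τ : ℝ → ℝ,
      (∀ t, 0 < t → NonHarmonic.HasHeatTrace S ν q A t (τ t)) ∧
      (∀ T, 0 < T → NonHarmonic.TwoSided τ
        (fun t => t ^ (-((Q + m) / q)) * NonHarmonic.heatIntegral q (Q + m) t) (Ioc 0 T)) ∧
      (m = -Q → ∀ T, 0 < T → T < 1 →
        NonHarmonic.TwoSided τ (fun t => -(1 / q * Real.log t)) (Ioc 0 T)) ∧
      (-Q < m → ∃ b : ℕ → ℝ,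
        b 0 = Real.Gamma ((Q + m) / q) / q ∧
        (∀ t, 0 < t → Summable fun k : ℕ => b k * t ^ ((k : ℝ) / q)) ∧
        (∀ p r : ℕ, q = p → Q + m = r → ∀ t, 0 < t →
          HasSum (fun k : ℕ => b k * t ^ ((k : ℝ) / q))
            (NonHarmonic.heatIntegral q (Q + m) t)) ∧
        (∀ t, 0 < t → HasSum (fun j : ℕ =>
            (-1) ^ j / (j.factorial * (Q + m + q * j)) * t ^ ((Q + m) / q + j))
            (b 0 - NonHarmonic.heatIntegral q (Q + m) t)) ∧
        (∀ T, 0 < T → NonHarmonic.TwoSided τ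
          (fun t => t ^ (-((Q + m) / q)) * ∑' k : ℕ, b k * t ^ ((k : ℝ) / q)) (Ioc 0 T))) := by
  obtain ⟨C, hC⟩ := hσ.order
  obtain ⟨C₀, N₀, hC₀, hell⟩ := hell
  have hw1 := S.one_le_weight hν
  have hw (ξ : ι) : 0 ≤ S.weight ν ξ ^ m := Real.rpow_nonneg (zero_le_one.trans (hw1 ξ)) m
  have hC' (x : M) (ξ : ι) : ‖σ x ξ‖ ≤ |C| * S.weight ν ξ ^ m :=
    (hC x ξ).trans (mul_le_mul_of_nonneg_right (le_abs_self C) (hw ξ))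
  have hnorm (x : M) (ξ : ι) : ‖σ x ξ‖ = (σ x ξ).re := by
    have h : σ x ξ = ((σ x ξ).re : ℂ) := Complex.ext rfl (hpos x ξ).2
    conv_lhs => rw [h]
    rw [Complex.norm_real, Real.norm_of_nonneg (hpos x ξ).1]
  have hmeas (ξ : ι) : AEStronglyMeasurable (fun x => σ x ξ) μ :=
    (hσ.smooth ξ).continuous.aestronglyMeasurable
  -- As `∫ |u_ξ|² = 1`, this is a mean of `σ(·, ξ)` and inherits its pointwise bounds.
  set g : ι → ℝ := fun ξ => ∫ x, (σ x ξ).re * ‖S.u ξ x‖ ^ 2 ∂μ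
  have hint (ξ : ι) : Integrable (fun x => (σ x ξ).re * ‖S.u ξ x‖ ^ 2) μ := by
    refine (S.integrable_norm_sq ξ).bdd_mul (c := |C| * S.weight ν ξ ^ m) ?_
      (Filter.Eventually.of_forall fun x => ?_)
    · exact (Complex.continuous_re.comp (hσ.smooth ξ).continuous).aestronglyMeasurable
    · rw [Real.norm_of_nonneg (hpos x ξ).1, ← hnorm]
      exact hC' x ξ
  have hg0 (ξ : ι) : 0 ≤ g ξ :=
    integral_nonneg fun x => mul_nonneg (hpos x ξ).1 (sq_nonneg _)
  have hgC (ξ : ι) : g ξ ≤ |C| * S.weight ν ξ ^ m := by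
    have h : g ξ ≤ ∫ x, |C| * S.weight ν ξ ^ m * ‖S.u ξ x‖ ^ 2 ∂μ :=
      integral_mono (hint ξ) ((S.integrable_norm_sq ξ).const_mul _) fun x =>
        mul_le_mul_of_nonneg_right ((hnorm x ξ).symm.trans_le (hC' x ξ)) (sq_nonneg _)
    rwa [integral_const_mul, S.integral_norm_sq, mul_one] at h
  have hgC₀ (ξ : ι) (hξ : (N₀ : ℝ) ≤ S.weight ν ξ) : C₀ * S.weight ν ξ ^ m ≤ g ξ := by
    have h : ∫ x, C₀ * S.weight ν ξ ^ m * ‖S.u ξ x‖ ^ 2 ∂μ ≤ g ξ :=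
      integral_mono ((S.integrable_norm_sq ξ).const_mul _) (hint ξ) fun x =>
        mul_le_mul_of_nonneg_right ((hell x ξ hξ).trans_eq (hnorm x ξ)) (sq_nonneg _)
    rwa [integral_const_mul, S.integral_norm_sq, mul_one] at h
  have hmain (T : ℝ) := NonHarmonic.twoSided_tsum (m := m) hw1 hWeyl.1 hWeyl.2 hQ hq hg0
    (abs_nonneg C) hgC hC₀ hgC₀ T
  refine ⟨fun t => ∑' ξ, g ξ * Real.exp (-t * S.weight ν ξ ^ q), fun t ht => ?_,
    fun T _ => hmain T, fun hm T _ hT1 => ?_, fun hm => ?_⟩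
  · exact hWeyl.hasHeatTrace hν hQ hq ht hL.isClosed hA hAσ hmeas hC' fun x ξ => (hpos x ξ).2
  · refine (hmain T).trans ?_
    subst hm
    simpa using NonHarmonic.twoSided_heatIntegral_zero hq hT1
  · have ha : 0 < Q + m := by linarith
    obtain ⟨b, hb0, hb, hb', hb''⟩ := NonHarmonic.exists_coefficients hq ha
    refine ⟨b, hb0, hb, hb', fun t ht => ?_, fun T hT => ?_⟩
    · rw [hb0]
      exact NonHarmonic.hasSum_heatIntegral hq ha ht
    · exact (hmain T).trans ((hb'' T hT).mul_left fun t ht => Real.rpow_nonneg ht.1.le _)
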